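/- Fix integers $d,N\ge 0$ and let $E$ be one of the real normed spaces $C^1_0([0,1],\mathbb{R}^d)$, $W^{1,1}_0([0,1],\mathbb{R}^d)$, $W^{1,2}_0([0,1],\mathbb{R}^d)$, where $W^{1,p}_0$ consists of the absolutely continuous $\sigma$ with $\sigma(0)=0$, $\dot\sigma\in L_p$, and $C^1_0$ of the $C^1$ curves with $\sigma(0)=0$. Put $E_0=\{\sigma\in E:\sigma(1)=0\}$. Let $g=\delta$ be the Euclidean metric or $g=\eta=\mathrm{diag}(1,-1,\dots,-1)$ the Minkowski metric on $\mathbb{R}^d$, with inverse $(g^{\mu\nu})$; repeated indices are summed. Lévy trace. A continuous bilinear map $Q$ into $M_N(\mathbb{C})$ belongs to the domain of the Lévy trace if for $u,v\in E_0$ $$Q(u,v)=\int_0^1\!\!\int_0^1 Q^V_{\mu\nu}(t,s)u^\mu(t)v^\nu(s)\,ds\,dt+\int_0^1 Q^L_{\mu\nu}(t)u^\mu(t)v^\nu(t)\,dt+\tfrac12\int_0^1 Q^S_{\mu\nu}(t)\bigl(\dot u^\mu(t)v^\nu(t)+\dot v^\mu(t)u^\nu(t)\bigr)dt$$ with $M_N(\mathbb{C})$-valued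 kernels $Q^V_{\mu\nu}\in L_1([0,1]^2)$, $Q^L_{\mu\nu}=Q^L_{\nu\mu}\in L_1[0,1]$, $Q^S_{\mu\nu}=-Q^S_{\nu\mu}\in L_\infty[0,1]$; then $\mathrm{tr}^g_LQ=\int_0^1 g^{\mu\nu}Q^L_{\mu\nu}(t)\,dt$. For $f\in C^2(E,M_N(\mathbb{C}))$ such that every $f''(\sigma)$ is in this domain, $D^2_{\mathrm{tr}^g_L}f(\sigma)=\mathrm{tr}^g_L f''(\sigma)$. For $B\in C^1(E,L(E_0,M_N(\mathbb{C})))$ such that, for every $\sigma\in E$, $(u,v)\mapsto\partial_uB(\sigma)v$ is in this domain, the Lévy divergence $\mathrm{div}^g_LB(\sigma)$ is the Lévy trace of $(u,v)\mapsto\partial_uB(\sigma)v$. Let $G$ be a closed subgroup of $U(N)$ with Lie algebra $\mathrm{Lie}(G)\subset u(N)$, and let $A_\mu(x)dx^\mu$ be a $C^\infty$ $\mathrm{Lie}(G)$-valued 1-form on $\mathbb{R}^d$. Put $\nabla_\mu\varphi=\partial_\mu\varphi+[A_\mu,\varphi]$ and $F_{\mu\nu}=\partial_\mu A_\nu-\partial_\nu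 A_\mu+[A_\mu,A_\nu]$. For $\sigma\in E$ and $0\le s\le t\le1$ let $U_{t,s}(\sigma)$ be the solution of $$\tfrac{d}{dt}U_{t,s}=-A_\mu(\sigma(t))\dot\sigma^\mu(t)U_{t,s},\qquad \tfrac{d}{ds}U_{t,s}=U_{t,s}A_\mu(\sigma(s))\dot\sigma^\mu(s),\qquad U_{s,s}=I_N$$ (understood in the integrated, i.e. Carathéodory, sense), and $U_{s,t}(\sigma)=U_{t,s}(\sigma)^{-1}$. Define $B^A(\sigma)u=U_{0,1}(\sigma)\,\partial_uU_{1,0}(\sigma)$ for $\sigma\in E$, $u\in E_0$. **Proposition.** The 1-form $B^A$ is in the domain of $\mathrm{div}^g_L$, the function $U_{1,0}$ is in the domain of $D^2_{\mathrm{tr}^g_L}$, and for every $\sigma\in E$ $$\mathrm{div}^g_LB^A(\sigma)=-\int_0^1U_{0,t}(\sigma)\,g^{\lambda\mu}\nabla_\lambda F_{\mu\nu}(\sigma(t))\,\dot\sigma^\nu(t)\,U_{t,0}(\sigma)\,dt=U_{0,1}(\sigma)\,D^2_{\mathrm{tr}^g_L}U_{1,0}(\sigma).$$ -/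

import Mathlib

open MeasureTheory
open scoped ContDiff Matrix.Norms.L2Operator

namespace LevyYM

/-- Lebesgue measure on `[0,1]`. -/
noncomputable abbrev unitMeasure : Measure ℝ := volume.restrict (Set.Icc 0 1)

/-- Euclidean space `ℝ^d`. -/
abbrev Space (d : ℕ) : Type := EuclideanSpace ℝ (Fin d)

/-- The matrices `M_N(ℂ)`. They carry the operator norm induced by the Euclidean norm on
`ℂ^N`; all norms on this finite-dimensional space are equivalent. -/
abbrev Mat (N : ℕ) : Type := Matrix (Fin N) (Fin N) ℂ

/-! ### The spaces of curves -/

/-- The three admissible classes of curves: `C^1_0`, `W^{1,1}_0` and `W^{1,2}_0`. -/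
inductive CurveClass : Type
  | C1
  | W11
  | W12

/-- The space to which the velocities belong:
`C([0,1],ℝ^d)`, `L_1((0,1),ℝ^d)` or `L_2((0,1),ℝ^d)`. -/
def VelocitySpace (d : ℕ) : CurveClass → Type
  | .C1 => C(unitInterval, Space d)
  | .W11 => Lp (Space d) 1 unitMeasure
  | .W12 => Lp (Space d) 2 unitMeasure

noncomputable instance (d : ℕ) : (k : CurveClass) → NormedAddCommGroup (VelocitySpace d k)
  | .C1 => inferInstanceAs (NormedAddCommGroup C(unitInterval, Space d))
  | .W11 => inferInstanceAs (NormedAddCommGroup (Lp (Space d) 1 unitMeasure))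
  | .W12 => inferInstanceAs (NormedAddCommGroup (Lp (Space d) 2 unitMeasure))

noncomputable instance (d : ℕ) : (k : CurveClass) → NormedSpace ℝ (VelocitySpace d k)
  | .C1 => inferInstanceAs (NormedSpace ℝ C(unitInterval, Space d))
  | .W11 => inferInstanceAs (NormedSpace ℝ (Lp (Space d) 1 unitMeasure))
  | .W12 => inferInstanceAs (NormedSpace ℝ (Lp (Space d) 2 unitMeasure))

/-- The velocity as a function of `t`; only its values for `t ∈ [0,1]` matter
(for the Lebesgue classes: up to a null set). -/
noncomputable def velocityFun {d : ℕ} : (k : CurveClass) → VelocitySpace d k → ℝ → Space d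
  | .C1, v => fun t => (show C(unitInterval, Space d) from v) (Set.projIcc 0 1 zero_le_one t)
  | .W11, v => (show Lp (Space d) 1 unitMeasure from v)
  | .W12, v => (show Lp (Space d) 2 unitMeasure from v)

theorem integrable_velocityFun {d : ℕ} (k : CurveClass) (v : VelocitySpace d k) :
    Integrable (velocityFun k v) unitMeasure := by
  cases k with
  | C1 =>
    have h : Continuous (velocityFun CurveClass.C1 v) :=
      (ContinuousMap.continuous (show C(unitInterval, Space d) from v)).comp continuous_projIcc
    exact h.integrableOn_Icc
  | W11 => exact (Lp.memLp (show Lp (Space d) 1 unitMeasure from v)).integrable le_rfl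
  | W12 => exact (Lp.memLp (show Lp (Space d) 2 unitMeasure from v)).integrable one_le_two

theorem velocityFun_add {d : ℕ} (k : CurveClass) (v w : VelocitySpace d k) :
    velocityFun k (v + w) =ᵐ[unitMeasure] velocityFun k v + velocityFun k w := by
  cases k with
  | C1 => exact Filter.EventuallyEq.rfl
  | W11 => exact Lp.coeFn_add (show Lp (Space d) 1 unitMeasure from v) w
  | W12 => exact Lp.coeFn_add (show Lp (Space d) 2 unitMeasure from v) w

theorem velocityFun_smul {d : ℕ} (k : CurveClass) (c : ℝ) (v : VelocitySpace d k) :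
    velocityFun k (c • v) =ᵐ[unitMeasure] c • velocityFun k v := by
  cases k with
  | C1 => exact Filter.EventuallyEq.rfl
  | W11 => exact Lp.coeFn_smul c (show Lp (Space d) 1 unitMeasure from v)
  | W12 => exact Lp.coeFn_smul c (show Lp (Space d) 2 unitMeasure from v)

theorem Ioc_subset_unit (t : unitInterval) : Set.Ioc (0 : ℝ) t ⊆ Set.Icc 0 1 :=
  fun _ hs => ⟨hs.1.le, hs.2.trans t.2.2⟩

theorem velocityFun_intervalIntegrable {d : ℕ} (k : CurveClass) (v : VelocitySpace d k)
    (t : unitInterval) : IntervalIntegrable (velocityFun k v) volume 0 t := by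
  rw [intervalIntegrable_iff_integrableOn_Ioc_of_le t.2.1]
  have h : IntegrableOn (velocityFun k v) (Set.Icc 0 1) := integrable_velocityFun k v
  exact h.mono_set (Ioc_subset_unit t)

theorem velocityFun_integral_congr {d : ℕ} {f g : ℝ → Space d} (h : f =ᵐ[unitMeasure] g)
    (t : unitInterval) : ∫ s in (0 : ℝ)..t, f s = ∫ s in (0 : ℝ)..t, g s := by
  apply intervalIntegral.integral_congr_ae_restrict
  rw [Set.uIoc_of_le t.2.1]
  exact ae_restrict_of_ae_restrict_of_subset (Ioc_subset_unit t) h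

/-- Pairs (continuous function on `[0,1]`, velocity), with the maximum norm. -/
def CurvePair (d : ℕ) (k : CurveClass) : Type := C(unitInterval, Space d) × VelocitySpace d k

noncomputable instance (d : ℕ) (k : CurveClass) : NormedAddCommGroup (CurvePair d k) :=
  inferInstanceAs (NormedAddCommGroup (C(unitInterval, Space d) × VelocitySpace d k))

noncomputable instance (d : ℕ) (k : CurveClass) : NormedSpace ℝ (CurvePair d k) :=
  inferInstanceAs (NormedSpace ℝ (C(unitInterval, Space d) × VelocitySpace d k))

/-- The space `E` of curves starting at the origin. An element is a continuous curve
`σ : [0,1] → ℝ^d` paired with its velocity `v = dσ/dt`, the two being tied by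
`σ(t) = ∫_0^t v(s) ds`. By the fundamental theorem of calculus, this says that `σ(0) = 0` and
that `σ` is continuously differentiable with derivative `v` (class `C1`), respectively that `σ`
is absolutely continuous with a.e. derivative `v ∈ L_p` (classes `W11`, `W12`). The norm is the
maximum of the sup norm of `σ` and the norm of `v` in its space. -/
noncomputable def curveSubmodule (d : ℕ) (k : CurveClass) :
    Submodule ℝ (CurvePair d k) where
  carrier := {x | ∀ t : unitInterval, x.1 t = ∫ s in (0 : ℝ)..t, velocityFun k x.2 s}
  zero_mem' := by
    intro t
    have h := velocityFun_smul (d := d) k 0 0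
    rw [zero_smul] at h
    change (0 : Space d) = ∫ s in (0 : ℝ)..t, velocityFun k 0 s
    simp [velocityFun_integral_congr h t]
  add_mem' := by
    intro x y hx hy t
    have h := velocityFun_integral_congr (velocityFun_add k x.2 y.2) t
    have h2 := intervalIntegral.integral_add (velocityFun_intervalIntegrable k x.2 t)
      (velocityFun_intervalIntegrable k y.2 t)
    change x.1 t + y.1 t = ∫ s in (0 : ℝ)..t, velocityFun k (x.2 + y.2) s
    rw [hx t, hy t, h, ← h2]
    rfl
  smul_mem' := by
    intro c x hx t
    have h := velocityFun_integral_congr (velocityFun_smul k c x.2) t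
    change c • x.1 t = ∫ s in (0 : ℝ)..t, velocityFun k (c • x.2) s
    rw [hx t, h, ← intervalIntegral.integral_smul]
    rfl

/-- The space `E` of curves: `C^1_0`, `W^{1,1}_0` or `W^{1,2}_0` on `[0,1]` with values
in `ℝ^d`. -/
abbrev Curve (d : ℕ) (k : CurveClass) : Type := curveSubmodule d k

/-- The point `σ(t)`, for `t ∈ [0,1]`. -/
noncomputable def position {d : ℕ} {k : CurveClass} (σ : Curve d k) (t : ℝ) : Space d :=
  σ.1.1 (Set.projIcc 0 1 zero_le_one t)

/-- The velocity of `σ` at time `t`, for (almost every) `t ∈ [0,1]`. -/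
noncomputable def velocity {d : ℕ} {k : CurveClass} (σ : Curve d k) (t : ℝ) : Space d :=
  velocityFun k σ.1.2 t

/-- The subspace `E_0` of the curves `σ ∈ E` with `σ(1) = 0`. -/
noncomputable def loopSubmodule (d : ℕ) (k : CurveClass) : Submodule ℝ (Curve d k) where
  carrier := {σ | position σ 1 = 0}
  zero_mem' := rfl
  add_mem' := by
    intro x y hx hy
    have h : position (x + y) 1 = position x 1 + position y 1 := rfl
    simp only [Set.mem_ofPred_eq] at hx hy ⊢
    rw [h, hx, hy, add_zero]
  smul_mem' := by
    intro c x hx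
    have h : position (c • x) 1 = c • position x 1 := rfl
    simp only [Set.mem_ofPred_eq] at hx ⊢
    rw [h, hx, smul_zero]

abbrev Loop (d : ℕ) (k : CurveClass) : Type := loopSubmodule d k

/-! ### The Lévy trace, the Lévy divergence and the second-order Lévy operator -/

/-- The Euclidean metric `δ` on `ℝ^d`. -/
def euclideanMetric (d : ℕ) : Matrix (Fin d) (Fin d) ℝ := 1

/-- The Minkowski metric `η = diag(1,-1,…,-1)` on `ℝ^d`. -/
def minkowskiMetric (d : ℕ) : Matrix (Fin d) (Fin d) ℝ :=
  Matrix.diagonal fun μ => if (μ : ℕ) = 0 then 1 else -1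

/-- `Q` is given on `E_0 × E_0` by the Volterra kernel `QV`, the Lévy kernel `QL` and the
singular kernel `QS`. -/
structure IsLevyRepresentation {d N : ℕ} {k : CurveClass}
    (Q : Loop d k →L[ℝ] Loop d k →L[ℝ] Mat N)
    (QV : Fin d → Fin d → ℝ → ℝ → Mat N) (QL QS : Fin d → Fin d → ℝ → Mat N) : Prop where
  volterra_integrable : ∀ μ ν,
    Integrable (fun p : ℝ × ℝ => QV μ ν p.1 p.2) (unitMeasure.prod unitMeasure)
  levy_integrable : ∀ μ ν, Integrable (QL μ ν) unitMeasure
  singular_bounded : ∀ μ ν, MemLp (QS μ ν) ⊤ unitMeasure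
  levy_symm : ∀ μ ν, ∀ᵐ t ∂unitMeasure, QL μ ν t = QL ν μ t
  singular_antisymm : ∀ μ ν, ∀ᵐ t ∂unitMeasure, QS μ ν t = -QS ν μ t
  apply_eq : ∀ u v : Loop d k, Q u v =
    (∫ t in (0 : ℝ)..1, ∫ s in (0 : ℝ)..1,
      ∑ μ, ∑ ν, (position u.1 t μ * position v.1 s ν) • QV μ ν t s)
    + (∫ t in (0 : ℝ)..1, ∑ μ, ∑ ν, (position u.1 t μ * position v.1 t ν) • QL μ ν t)
    + (1 / 2 : ℝ) • ∫ t in (0 : ℝ)..1, ∑ μ, ∑ ν,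
        (velocity u.1 t μ * position v.1 t ν + velocity v.1 t μ * position u.1 t ν) • QS μ ν t

/-- `Q` belongs to the domain of the Lévy trace. -/
def InLevyTraceDomain {d N : ℕ} {k : CurveClass}
    (Q : Loop d k →L[ℝ] Loop d k →L[ℝ] Mat N) : Prop :=
  ∃ QV QL QS, IsLevyRepresentation Q QV QL QS

/-- `T = ∫_0^1 g^{μν} QL_{μν}(t) dt` for some representation of `Q`. -/
def HasLevyTrace {d N : ℕ} {k : CurveClass} (g : Matrix (Fin d) (Fin d) ℝ)
    (Q : Loop d k →L[ℝ] Loop d k →L[ℝ] Mat N) (T : Mat N) : Prop :=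
  ∃ QV QL QS, IsLevyRepresentation Q QV QL QS ∧
    T = ∫ t in (0 : ℝ)..1, ∑ μ, ∑ ν, g⁻¹ μ ν • QL μ ν t

/-- The Lévy trace `tr^g_L Q = ∫_0^1 g^{μν} QL_{μν}(t) dt`, meaningful on its domain. -/
noncomputable def levyTrace {d N : ℕ} {k : CurveClass} (g : Matrix (Fin d) (Fin d) ℝ)
    (Q : Loop d k →L[ℝ] Loop d k →L[ℝ] Mat N) : Mat N :=
  Classical.epsilon (HasLevyTrace g Q)

/-- The restriction of `B'(σ)` to `E_0 × E_0`, that is `(u, v) ↦ ∂_u B(σ) v`. -/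
noncomputable def firstDerivative {d N : ℕ} {k : CurveClass}
    (B : Curve d k → (Loop d k →L[ℝ] Mat N)) (σ : Curve d k) :
    Loop d k →L[ℝ] Loop d k →L[ℝ] Mat N :=
  (fderiv ℝ B σ).comp (loopSubmodule d k).subtypeL

/-- The restriction of `f''(σ)` to `E_0 × E_0`. -/
noncomputable def secondDerivative {d N : ℕ} {k : CurveClass}
    (f : Curve d k → Mat N) (σ : Curve d k) : Loop d k →L[ℝ] Loop d k →L[ℝ] Mat N :=
  (fderiv ℝ (fderiv ℝ f) σ).bilinearComp
    (loopSubmodule d k).subtypeL (loopSubmodule d k).subtypeL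

/-- `B ∈ dom div^g_L`. -/
def InDivergenceDomain {d N : ℕ} {k : CurveClass}
    (B : Curve d k → (Loop d k →L[ℝ] Mat N)) : Prop :=
  ContDiff ℝ 1 B ∧ ∀ σ, InLevyTraceDomain (firstDerivative B σ)

/-- The Lévy divergence `div^g_L B(σ) = tr^g_L B'(σ)`. -/
noncomputable def levyDivergence {d N : ℕ} {k : CurveClass} (g : Matrix (Fin d) (Fin d) ℝ)
    (B : Curve d k → (Loop d k →L[ℝ] Mat N)) (σ : Curve d k) : Mat N :=
  levyTrace g (firstDerivative B σ)

/-- `f ∈ dom D^2_{tr^g_L}`. -/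
def InSecondOrderDomain {d N : ℕ} {k : CurveClass} (f : Curve d k → Mat N) : Prop :=
  ContDiff ℝ 2 f ∧ ∀ σ, InLevyTraceDomain (secondDerivative f σ)

/-- The operator `D^2_{tr^g_L} f(σ) = tr^g_L f''(σ)`: the Lévy Laplacian for `g = δ`, the Lévy
d'Alembertian for `g = η`. -/
noncomputable def levySecondOrder {d N : ℕ} {k : CurveClass} (g : Matrix (Fin d) (Fin d) ℝ)
    (f : Curve d k → Mat N) (σ : Curve d k) : Mat N :=
  levyTrace g (secondDerivative f σ)

/-! ### Connections, curvature and parallel transport -/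

/-- The Lie algebra of a (closed) subgroup of `U(N)`. -/
def lieAlgebra {N : ℕ} (G : Subgroup (Matrix.unitaryGroup (Fin N) ℂ)) : Set (Mat N) :=
  {X | ∀ t : ℝ, ∃ a ∈ G, (a : Mat N) = NormedSpace.exp (t • X)}

/-- The partial derivative `∂_μ φ`. -/
noncomputable def partialDeriv {d N : ℕ} (μ : Fin d) (φ : Space d → Mat N) (x : Space d) : Mat N :=
  fderiv ℝ φ x (EuclideanSpace.single μ 1)

/-- The covariant derivative `∇_μ φ = ∂_μ φ + [A_μ, φ]`. -/
noncomputable def covDeriv {d N : ℕ} (A : Fin d → Space d → Mat N) (μ : Fin d)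
    (φ : Space d → Mat N) (x : Space d) : Mat N :=
  partialDeriv μ φ x + (A μ x * φ x - φ x * A μ x)

/-- The curvature `F_{μν} = ∂_μ A_ν - ∂_ν A_μ + [A_μ, A_ν]`. -/
noncomputable def curvature {d N : ℕ} (A : Fin d → Space d → Mat N) (μ ν : Fin d)
    (x : Space d) : Mat N :=
  partialDeriv μ (A ν) x - partialDeriv ν (A μ) x + (A μ x * A ν x - A ν x * A μ x)

/-- The value `A_μ(σ(t)) (dσ^μ/dt)(t)`. -/
noncomputable def alongCurve {d N : ℕ} {k : CurveClass} (A : Fin d → Space d → Mat N)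
    (σ : Curve d k) (t : ℝ) : Mat N :=
  ∑ μ, velocity σ t μ • A μ (position σ t)

/-- `U t s`, `0 ≤ s ≤ t ≤ 1`, is a (Carathéodory) solution of
`d/dt U_{t,s} = -A_μ(σ(t)) σ'^μ(t) U_{t,s}`, `d/ds U_{t,s} = U_{t,s} A_μ(σ(s)) σ'^μ(s)`,
`U_{s,s} = 1`, and `U_{s,t} = U_{t,s}⁻¹`. These conditions have exactly one solution on
`[0,1] × [0,1]`. The equations are written in integrated form since the velocity need only be
integrable. -/
structure IsParallelTransport {d N : ℕ} {k : CurveClass} (A : Fin d → Space d → Mat N)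
    (σ : Curve d k) (U : ℝ → ℝ → Mat N) : Prop where
  continuousOn_left : ∀ s ∈ Set.Icc (0 : ℝ) 1, ContinuousOn (fun t => U t s) (Set.Icc s 1)
  continuousOn_right : ∀ t ∈ Set.Icc (0 : ℝ) 1, ContinuousOn (fun s => U t s) (Set.Icc 0 t)
  left_eq : ∀ s t, 0 ≤ s → s ≤ t → t ≤ 1 →
    U t s = 1 - ∫ r in s..t, alongCurve A σ r * U r s
  right_eq : ∀ s t, 0 ≤ s → s ≤ t → t ≤ 1 →
    U t s = 1 - ∫ r in s..t, U t r * alongCurve A σ r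
  inverse : ∀ s t, 0 ≤ s → s ≤ t → t ≤ 1 → U s t = (U t s)⁻¹

/-- The parallel transport `U^A_{t,s}(σ)`, for `s, t ∈ [0,1]`. -/
noncomputable def parallelTransport {d N : ℕ} {k : CurveClass} (A : Fin d → Space d → Mat N)
    (t s : ℝ) (σ : Curve d k) : Mat N :=
  Classical.epsilon (IsParallelTransport A σ) t s

/-- The 1-form `B^A(σ) u = U^A_{0,1}(σ) ∂_u U^A_{1,0}(σ)`, `u ∈ E_0`. -/
noncomputable def transportForm {d N : ℕ} {k : CurveClass} (A : Fin d → Space d → Mat N)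
    (σ : Curve d k) : Loop d k →L[ℝ] Mat N :=
  ((ContinuousLinearMap.mul ℝ (Mat N) (parallelTransport A 0 1 σ)).comp
    (fderiv ℝ (parallelTransport A 1 0) σ)).comp (loopSubmodule d k).subtypeL

end LevyYM

open LevyYM

namespace LevyYM

open Set Filter Topology

/-! ### Absolutely continuous functions on `[0,1]` -/

section Primitive

variable {X F R : Type*} [NormedAddCommGroup X] [NormedSpace ℝ X]
  [NormedAddCommGroup F] [NormedSpace ℝ F] [NormedRing R] [NormedAlgebra ℝ R]

/-! Write `W_t = U_{t,0}` and `Z_t = U_{0,t}` (`transport` and `cotransport`). Both solve linear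
Volterra equations in the Banach algebra of continuous matrix-valued paths. Volterra operators are
quasi-nilpotent, so `W` is `(1 - S)⁻¹ 1` with `S` depending smoothly on `σ`. Smoothness of inversion
then makes `W` and `Z` smooth functions of the curve, and differentiating the integral equation is
legitimate.

The first variation is the non-abelian Stokes formula `Z ∂_w W = -w^i Z A_i W - M_w`, where `M_w(t)
= ∫_0^t Z F_{μν} w^μ σ'^ν W` (`cotransport_mul_fderiv_transport`, `curvatureForm`). For a loop the
gauge term vanishes at `t = 1`, so `B^A(σ) v = -M_v(1)`. The variation of a framed function `Z Φ(σ)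
W` is `w^i Z ∇_i Φ W + [M_w, Z Φ W]` (`fderiv_frame_apply`). Hence `-∂_w B^A v` is the integral of
the framed sum of `F_{μν} v^μ w'^ν` and `∇_i F_{μν} w^i v^μ σ'^ν`, plus a commutator term.

The commutator is a double integral over `t < s` and gives the Volterra kernel. In the `w'` term,
half of the total derivative of `Z F_{μν} w^μ v^ν W` is removed; its integral over `[0,1]` is zero,
and the antisymmetry of `F` leaves the singular kernel `F_{μν}` and the Lévy kernel `-(∇_μ F_{νκ} +
½ ∇_κ F_{μν}) σ'^κ`, framed by `Z` and `W` (`levy_kernel_identity`, `isLevyRepresentation_kernels`).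
The Bianchi identity makes the latter symmetric. On the diagonal the second summand drops out, and
contraction with the diagonal inverse metric yields the Yang–Mills current. The second derivative of
`U_{1,0}` is `U_{1,0} (M_w(1) M_v(1) + ∂_w B v)`; the product changes only the Volterra kernel, so
the two Lévy traces differ by the factor `U_{1,0}`.

The trace is defined through a choice of representation, so its uniqueness must be shown. On `u_n =
sin(nπt) e_a` the singular term is zero, and by Riemann–Lebesgue `2 Q(u_n, u_n)` tends to `∫
QL_{aa}` (`IsLevyRepresentation.tendsto`). Diagonal entries suffice because both metrics are
diagonal. -/

theorem _root_.AbsolutelyContinuousOnInterval.of_dist_le {Y₁ Y₂ Y : Type*} [PseudoMetricSpace Y₁]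
    [PseudoMetricSpace Y₂] [PseudoMetricSpace Y]
    {f : ℝ → Y} {g : ℝ → Y₁} {h : ℝ → Y₂} {a b : ℝ} (C : ℝ)
    (hg : AbsolutelyContinuousOnInterval g a b) (hh : AbsolutelyContinuousOnInterval h a b)
    (H : ∀ x ∈ uIcc a b, ∀ y ∈ uIcc a b,
      dist (f x) (f y) ≤ C * (dist (g x) (g y) + dist (h x) (h y))) :
    AbsolutelyContinuousOnInterval f a b := by
  have h0 := (Tendsto.add hg hh).const_mul C
  rw [add_zero, mul_zero] at h0
  refine squeeze_zero' (Eventually.of_forall fun E => Finset.sum_nonneg fun _ _ => dist_nonneg)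
    ?_ h0
  have : ∀ᶠ E : ℕ × (ℕ → ℝ × ℝ) in AbsolutelyContinuousOnInterval.totalLengthFilter ⊓
      𝓟 (AbsolutelyContinuousOnInterval.disjWithin a b),
      E ∈ AbsolutelyContinuousOnInterval.disjWithin a b :=
    eventually_inf_principal.mpr (by simp)
  filter_upwards [this] with E hE
  rw [← Finset.sum_add_distrib, Finset.mul_sum]
  exact Finset.sum_le_sum fun i hi => H _ (hE.1 i hi).1 _ (hE.1 i hi).2


theorem integrable_unit_iff {F : Type*} [NormedAddCommGroup F] {p : ℝ → F} :
    Integrable p unitMeasure ↔ IntervalIntegrable p volume 0 1 := by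
  rw [intervalIntegrable_iff_integrableOn_Icc_of_le zero_le_one]
  rfl

theorem intervalIntegrable_of_unit {F : Type*} [NormedAddCommGroup F] {p : ℝ → F} (hp : Integrable p unitMeasure) {s t : ℝ}
    (hs : s ∈ Icc (0 : ℝ) 1) (ht : t ∈ Icc (0 : ℝ) 1) : IntervalIntegrable p volume s t := by
  refine (integrable_unit_iff.1 hp).mono_set ?_
  rw [uIcc_of_le zero_le_one]
  exact uIcc_subset_Icc hs ht

theorem integral_unit_congr {p q : ℝ → F} (h : p =ᵐ[unitMeasure] q) {s t : ℝ}
    (hs : s ∈ Icc (0 : ℝ) 1) (ht : t ∈ Icc (0 : ℝ) 1) : ∫ r in s..t, p r = ∫ r in s..t, q r :=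
  intervalIntegral.integral_congr_ae_restrict (ae_restrict_of_ae_restrict_of_subset
    (uIoc_subset_uIcc.trans (uIcc_subset_Icc hs ht)) h)

theorem integral_unit_eq (p : ℝ → F) : ∫ r in (0 : ℝ)..1, p r = ∫ r, p r ∂unitMeasure := by
  rw [intervalIntegral.integral_of_le zero_le_one, ← integral_Icc_eq_integral_Ioc]

/-- `h` is absolutely continuous on `[0,1]` with a.e. derivative `p`. -/
structure IsPrimitive (h p : ℝ → F) : Prop where
  ac : AbsolutelyContinuousOnInterval h 0 1
  integrable : Integrable p unitMeasure
  deriv : ∀ᵐ t ∂unitMeasure, HasDerivAt h (p t) t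

theorem ae_unit_iff {P : ℝ → Prop} :
    (∀ᵐ t ∂unitMeasure, P t) ↔ ∀ᵐ t, t ∈ uIcc (0 : ℝ) 1 → P t := by
  rw [ae_restrict_iff' measurableSet_Icc, uIcc_of_le zero_le_one]

theorem absolutelyContinuousOnInterval_integral {p : ℝ → F} (hp : Integrable p unitMeasure) :
    AbsolutelyContinuousOnInterval (fun t => ∫ s in (0 : ℝ)..t, p s) 0 1 := by
  have h1 := (integrable_unit_iff.1 hp).norm.absolutelyContinuousOnInterval_intervalIntegral
    (c := 0) (by simp)
  refine h1.of_dist_le 1 h1 fun x hx y hy => ?_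
  rw [uIcc_of_le zero_le_one] at hx hy
  have h0 : (0 : ℝ) ∈ Icc (0 : ℝ) 1 := by simp
  rw [dist_eq_norm, intervalIntegral.integral_interval_sub_left
    (intervalIntegrable_of_unit hp h0 hx) (intervalIntegrable_of_unit hp h0 hy), dist_eq_norm,
    intervalIntegral.integral_interval_sub_left
    (intervalIntegrable_of_unit hp.norm h0 hx) (intervalIntegrable_of_unit hp.norm h0 hy)]
  refine (intervalIntegral.norm_integral_le_abs_integral_norm).trans ?_
  rw [Real.norm_eq_abs]
  linarith [abs_nonneg (∫ r in y..x, ‖p r‖)]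

namespace IsPrimitive

variable {h k p q : ℝ → F}

theorem congr_ae (hh : IsPrimitive h p) (hpq : p =ᵐ[unitMeasure] q) : IsPrimitive h q :=
  ⟨hh.ac, hh.integrable.congr hpq, by
    filter_upwards [hh.deriv, hpq] with t h1 h2 using h2 ▸ h1⟩

theorem congr (hh : IsPrimitive h p) (hpq : ∀ t ∈ Icc (0 : ℝ) 1, p t = q t) : IsPrimitive h q :=
  hh.congr_ae (by
    filter_upwards [ae_restrict_mem measurableSet_Icc] with t ht using hpq t ht)

theorem const (c : F) : IsPrimitive (fun _ => c) (fun _ => (0 : F)) := by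
  refine ⟨?_, integrable_zero _ _ _, Eventually.of_forall fun t => hasDerivAt_const t c⟩
  have : LipschitzOnWith 0 (fun _ : ℝ => c) (uIcc 0 1) := by
    intro x _ y _; simp
  exact this.absolutelyContinuousOnInterval

theorem add (hh : IsPrimitive h p) (hk : IsPrimitive k q) :
    IsPrimitive (fun t => h t + k t) (fun t => p t + q t) :=
  ⟨hh.ac.add hk.ac, hh.integrable.add hk.integrable, by
    filter_upwards [hh.deriv, hk.deriv] with t h1 h2 using h1.add h2⟩

theorem neg (hh : IsPrimitive h p) : IsPrimitive (fun t => -h t) (fun t => -p t) :=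
  ⟨hh.ac.neg, hh.integrable.neg, by filter_upwards [hh.deriv] with t h1 using h1.neg⟩

theorem sub (hh : IsPrimitive h p) (hk : IsPrimitive k q) :
    IsPrimitive (fun t => h t - k t) (fun t => p t - q t) :=
  ⟨hh.ac.sub hk.ac, hh.integrable.sub hk.integrable, by
    filter_upwards [hh.deriv, hk.deriv] with t h1 h2 using h1.sub h2⟩

theorem sum {ι : Type*} {s : Finset ι} {h p : ι → ℝ → F}
    (H : ∀ i ∈ s, IsPrimitive (h i) (p i)) :
    IsPrimitive (fun t => ∑ i ∈ s, h i t) (fun t => ∑ i ∈ s, p i t) := by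
  classical
  induction s using Finset.induction_on with
  | empty => simpa using const (0 : F)
  | insert a s ha ih =>
    simp only [Finset.sum_insert ha]
    exact (H a (Finset.mem_insert_self _ _)).add
      (ih fun i hi => H i (Finset.mem_insert_of_mem hi))

theorem continuousOn (hh : IsPrimitive h p) : ContinuousOn h (Icc 0 1) := by
  have := hh.ac.continuousOn
  rwa [uIcc_of_le zero_le_one] at this

theorem mul {h k p q : ℝ → R} (hh : IsPrimitive h p) (hk : IsPrimitive k q) :
    IsPrimitive (fun t => h t * k t) (fun t => p t * k t + h t * q t) := by
  obtain ⟨C, hC⟩ := hh.ac.exists_bound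
  obtain ⟨D, hD⟩ := hk.ac.exists_bound
  refine ⟨hh.ac.of_dist_le (max C D) hk.ac fun x hx y hy => ?_, ?_, ?_⟩
  · have e : h x * k x - h y * k y = (h x - h y) * k x + h y * (k x - k y) := by noncomm_ring
    rw [dist_eq_norm, e, dist_eq_norm, dist_eq_norm, mul_add]
    refine (norm_add_le _ _).trans (add_le_add ?_ ?_)
    · refine (norm_mul_le _ _).trans ?_
      rw [mul_comm]
      exact mul_le_mul_of_nonneg_right ((hD x hx).trans (le_max_right _ _)) (norm_nonneg _)
    · refine (norm_mul_le _ _).trans ?_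
      exact mul_le_mul_of_nonneg_right ((hC y hy).trans (le_max_left _ _)) (norm_nonneg _)
  · have h1 : IntegrableOn p (Icc 0 1) := hh.integrable
    have h2 : IntegrableOn q (Icc 0 1) := hk.integrable
    exact (h1.mul_continuousOn hk.continuousOn isCompact_Icc).add
      (h2.continuousOn_mul hh.continuousOn isCompact_Icc)
  · filter_upwards [hh.deriv, hk.deriv] with t h1 h2 using h1.mul h2

/-- A `C^1` map is locally Lipschitz, hence Lipschitz on the compact image of `h`; this preserves
absolute continuity. -/
theorem comp [CompleteSpace X] {h p : ℝ → X} (hh : IsPrimitive h p) {Φ : X → F}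
    (hΦ : ContDiff ℝ 1 Φ) :
    IsPrimitive (fun t => Φ (h t)) (fun t => fderiv ℝ Φ (h t) (p t)) := by
  have hc : IsCompact (h '' Icc 0 1) := isCompact_Icc.image_of_continuousOn hh.continuousOn
  obtain ⟨K, hK⟩ := (hΦ.locallyLipschitz.locallyLipschitzOn).exists_lipschitzOnWith_of_compact hc
  refine ⟨hh.ac.of_dist_le K hh.ac fun x hx y hy => ?_, ?_, ?_⟩
  · rw [uIcc_of_le zero_le_one] at hx hy
    refine (hK.dist_le_mul _ (mem_image_of_mem _ hx) _ (mem_image_of_mem _ hy)).trans ?_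
    exact mul_le_mul_of_nonneg_left (by linarith [dist_nonneg (x := h x) (y := h y)]) K.2
  · have h1 : ContinuousOn (fun t => fderiv ℝ Φ (h t)) (Icc 0 1) :=
      (hΦ.continuous_fderiv one_ne_zero).comp_continuousOn hh.continuousOn
    obtain ⟨C, hC⟩ := isCompact_Icc.exists_bound_of_continuousOn h1
    refine Integrable.mono' (hh.integrable.norm.const_mul C) ?_ ?_
    · have h2 := h1.aestronglyMeasurable (μ := volume) measurableSet_Icc
      exact (ContinuousLinearMap.apply ℝ F).flip.aestronglyMeasurable_comp₂ h2
        hh.integrable.aestronglyMeasurable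
    · filter_upwards [ae_restrict_mem measurableSet_Icc] with t ht
      exact (ContinuousLinearMap.le_opNorm _ _).trans
        (mul_le_mul_of_nonneg_right (hC t ht) (norm_nonneg _))
  · filter_upwards [hh.deriv] with t h1
    exact ((hΦ.differentiable one_ne_zero).differentiableAt.hasFDerivAt).comp_hasDerivAt t h1

theorem clm_comp (L : X →L[ℝ] F) {h p : ℝ → X} (hh : IsPrimitive h p) :
    IsPrimitive (fun t => L (h t)) (fun t => L (p t)) := by
  refine ⟨hh.ac.of_dist_le ‖L‖ hh.ac fun x hx y hy => ?_, L.integrable_comp hh.integrable, ?_⟩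
  · refine (L.lipschitz.dist_le_mul _ _).trans ?_
    exact mul_le_mul_of_nonneg_left (by linarith [dist_nonneg (x := h x) (y := h y)])
      (norm_nonneg _)
  · filter_upwards [hh.deriv] with t h1 using L.hasFDerivAt.comp_hasDerivAt t h1

variable [CompleteSpace F]

theorem of_integral (hp : Integrable p unitMeasure) (c : F)
    (H : ∀ t ∈ Icc (0 : ℝ) 1, h t = c + ∫ s in (0 : ℝ)..t, p s) : IsPrimitive h p := by
  have h1 := absolutelyContinuousOnInterval_integral hp
  refine ⟨h1.of_dist_le 1 h1 fun x hx y hy => ?_, hp, ?_⟩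
  · rw [uIcc_of_le zero_le_one] at hx hy
    rw [H x hx, H y hy, dist_add_left]
    linarith [dist_nonneg (x := ∫ s in (0 : ℝ)..x, p s) (y := ∫ s in (0 : ℝ)..y, p s)]
  · have h2 := (integrable_unit_iff.1 hp).ae_hasDerivAt_integral
    -- The formula for `h` is known only on `[0,1]`, while `HasDerivAt` is two-sided; the endpoints
    -- are discarded as a null set.
    have h3 : ∀ᵐ t : ℝ, t ≠ 0 := by simp [ae_iff, measure_singleton]
    have h4 : ∀ᵐ t : ℝ, t ≠ 1 := by simp [ae_iff, measure_singleton]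
    rw [ae_unit_iff]
    filter_upwards [h2, h3, h4] with t ht h0 h1 hm
    have hd := (ht hm 0 (by simp)).const_add c
    rw [uIcc_of_le zero_le_one] at hm
    refine hd.congr_of_eventuallyEq ?_
    filter_upwards [Ioo_mem_nhds (lt_of_le_of_ne hm.1 h0.symm) (lt_of_le_of_ne hm.2 h1)] with s hs
    exact H s ⟨hs.1.le, hs.2.le⟩

/-- The difference between `h` and the integral of `p` is absolutely continuous with zero derivative
a.e., hence constant. -/
theorem eq_add_integral (hh : IsPrimitive h p) {t : ℝ} (ht : t ∈ Icc (0 : ℝ) 1) :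
    h t = h 0 + ∫ s in (0 : ℝ)..t, p s := by
  have h1 : IsPrimitive (fun t => ∫ s in (0 : ℝ)..t, p s) p :=
    of_integral hh.integrable 0 fun t _ => by simp
  have h2 := hh.sub h1
  obtain ⟨C, hC⟩ := h2.ac.const_of_ae_hasDerivAt_zero (by
    rw [← ae_unit_iff]
    filter_upwards [h2.deriv] with t h using by simpa using h)
  rw [uIcc_of_le zero_le_one] at hC
  have h3 := (hC t ht).trans (hC 0 (by simp)).symm
  simp only [intervalIntegral.integral_same, sub_zero] at h3
  rw [← h3]; abel

theorem integral_eq (hh : IsPrimitive h p) {s t : ℝ} (hs : s ∈ Icc (0 : ℝ) 1)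
    (ht : t ∈ Icc (0 : ℝ) 1) : ∫ r in s..t, p r = h t - h s := by
  have h0 : (0 : ℝ) ∈ Icc (0 : ℝ) 1 := by simp
  rw [hh.eq_add_integral ht, hh.eq_add_integral hs, add_sub_add_left_eq_sub,
    intervalIntegral.integral_interval_sub_left (intervalIntegrable_of_unit hh.integrable h0 ht)
      (intervalIntegrable_of_unit hh.integrable h0 hs)]

/-- The uniqueness tool behind the identities between paths below: equal derivatives a.e. and equal
values at `0`. -/
theorem eqOn (hh : IsPrimitive h p) (hk : IsPrimitive k q) (hpq : p =ᵐ[unitMeasure] q)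
    (h0 : h 0 = k 0) {t : ℝ} (ht : t ∈ Icc (0 : ℝ) 1) : h t = k t := by
  rw [hh.eq_add_integral ht, hk.eq_add_integral ht, h0, integral_unit_congr hpq (by simp) ht]

end IsPrimitive

end Primitive

/-! ### Curves -/

section Curves

variable {d N : ℕ} {k : CurveClass}

theorem integrable_velocity (σ : Curve d k) : Integrable (velocity σ) unitMeasure :=
  integrable_velocityFun k σ.1.2

theorem velocity_add (σ τ : Curve d k) :
    velocity (σ + τ) =ᵐ[unitMeasure] fun t => velocity σ t + velocity τ t :=
  velocityFun_add k σ.1.2 τ.1.2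

theorem velocity_smul (c : ℝ) (σ : Curve d k) :
    velocity (c • σ) =ᵐ[unitMeasure] fun t => c • velocity σ t :=
  velocityFun_smul k c σ.1.2

/-- This `L_1` bound allows the three classes of curves to be treated at once: later estimates use
only it and the sup norm of the position. For `L_2` it is Hölder's inequality on a probability
space. -/
theorem integral_norm_velocityFun_le (v : VelocitySpace d k) :
    ∫ t, ‖velocityFun k v t‖ ∂unitMeasure ≤ ‖v‖ := by
  have hprob : IsProbabilityMeasure unitMeasure := ⟨by simp⟩
  cases k with
  | C1 =>
    have h : ∀ t, ‖velocityFun CurveClass.C1 v t‖ ≤ ‖v‖ := fun t =>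
      (show C(unitInterval, Space d) from v).norm_coe_le_norm _
    have := integral_mono (integrable_velocityFun CurveClass.C1 v).norm
      (integrable_const (μ := unitMeasure) ‖v‖) h
    simpa using this
  | W11 =>
    have h := L1.norm_eq_integral_norm (show Lp (Space d) 1 unitMeasure from v)
    exact h.symm.le
  | W12 =>
    set f : Lp (Space d) 2 unitMeasure := v with hf
    have h1 : eLpNorm f 1 unitMeasure ≤ eLpNorm f 2 unitMeasure :=
      eLpNorm_le_eLpNorm_of_exponent_le one_le_two (Lp.aestronglyMeasurable f)
    have h2 : ‖v‖ = (eLpNorm f 2 unitMeasure).toReal := Lp.norm_def f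
    have h3 : ∫ t, ‖velocityFun CurveClass.W12 v t‖ ∂unitMeasure
        = (eLpNorm f 1 unitMeasure).toReal := by
      rw [eLpNorm_one_eq_lintegral_enorm]
      exact integral_norm_eq_lintegral_enorm (Lp.aestronglyMeasurable f)
    rw [h2, h3]
    exact ENNReal.toReal_mono (Lp.eLpNorm_ne_top f) h1

theorem integral_norm_velocity_le (σ : Curve d k) :
    ∫ t, ‖velocity σ t‖ ∂unitMeasure ≤ ‖σ‖ :=
  (integral_norm_velocityFun_le σ.1.2).trans (norm_snd_le (σ.1 : C(unitInterval, Space d) × _))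

theorem isPrimitive_position (σ : Curve d k) : IsPrimitive (position σ) (velocity σ) := by
  refine IsPrimitive.of_integral (integrable_velocity σ) 0 fun t ht => ?_
  rw [position, Set.projIcc_of_mem zero_le_one ht, σ.2 ⟨t, ht⟩, zero_add]
  rfl

theorem position_zero (σ : Curve d k) : position σ 0 = 0 := by
  rw [position, Set.projIcc_of_mem zero_le_one (by simp : (0 : ℝ) ∈ Icc (0 : ℝ) 1), σ.2]
  simp

theorem position_one (u : Loop d k) : position u.1 1 = 0 := u.2

theorem continuous_position (σ : Curve d k) : Continuous (position σ) :=
  σ.1.1.continuous.comp continuous_projIcc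

theorem isPrimitive_position_apply (σ : Curve d k) (i : Fin d) :
    IsPrimitive (fun t => position σ t i) (fun t => velocity σ t i) :=
  (isPrimitive_position σ).clm_comp (EuclideanSpace.proj (𝕜 := ℝ) i)

theorem integrable_velocity_apply (σ : Curve d k) (i : Fin d) :
    Integrable (fun t => velocity σ t i) unitMeasure :=
  (isPrimitive_position_apply σ i).integrable

theorem integral_norm_velocity_apply_le (σ : Curve d k) (i : Fin d) :
    ∫ t, ‖velocity σ t i‖ ∂unitMeasure ≤ ‖σ‖ :=
  (integral_mono (integrable_velocity_apply σ i).norm (integrable_velocity σ).norm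
    fun _ => PiLp.norm_apply_le _ i).trans (integral_norm_velocity_le σ)

/-- Continuous matrix-valued functions on `[0,1]`. -/
abbrev Path (N : ℕ) : Type := C(unitInterval, Mat N)

/-- The extension of a continuous function on `[0,1]` to the real line, constant outside. -/
noncomputable def ext (f : Path N) (t : ℝ) : Mat N := f (Set.projIcc 0 1 zero_le_one t)

theorem continuous_ext (f : Path N) : Continuous (ext f) := f.continuous.comp continuous_projIcc

theorem norm_ext_le (f : Path N) (t : ℝ) : ‖ext f t‖ ≤ ‖f‖ := f.norm_coe_le_norm _

theorem ext_coe (f : Path N) (t : unitInterval) : ext f t = f t := by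
  rw [ext, Set.projIcc_val]

theorem ext_mul (f g : Path N) (t : ℝ) : ext (f * g) t = ext f t * ext g t := rfl
theorem ext_add (f g : Path N) (t : ℝ) : ext (f + g) t = ext f t + ext g t := rfl
theorem ext_sub (f g : Path N) (t : ℝ) : ext (f - g) t = ext f t - ext g t := rfl
theorem ext_neg (f : Path N) (t : ℝ) : ext (-f) t = -ext f t := rfl
theorem ext_one (t : ℝ) : ext (1 : Path N) t = 1 := rfl
theorem ext_sum {ι : Type*} (s : Finset ι) (f : ι → Path N) (t : ℝ) :
    ext (∑ i ∈ s, f i) t = ∑ i ∈ s, ext (f i) t := by simp [ext]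

theorem path_ext {f g : Path N} (h : ∀ t ∈ Icc (0 : ℝ) 1, ext f t = ext g t) : f = g := by
  ext1 t
  rw [← ext_coe, ← ext_coe, h t t.2]

theorem integrable_velocity_smul (σ : Curve d k) (i : Fin d) {f : ℝ → Mat N} (hf : Continuous f) :
    Integrable (fun t => velocity σ t i • f t) unitMeasure := by
  have h : IntegrableOn (fun t => velocity σ t i) (Icc 0 1) := integrable_velocity_apply σ i
  exact h.smul_continuousOn hf.continuousOn isCompact_Icc

/-- `t ↦ ∫_0^t (dσ^i/ds) f(s) ds`. -/
noncomputable def volterraFun (i : Fin d) (σ : Curve d k) (f : Path N) : Path N where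
  toFun t := ∫ s in (0 : ℝ)..t, velocity σ s i • ext f s
  continuous_toFun := by
    have h := (absolutelyContinuousOnInterval_integral
      (integrable_velocity_smul σ i (continuous_ext f))).continuousOn
    rw [uIcc_of_le zero_le_one] at h
    exact continuousOn_iff_continuous_domRestrict.1 h

theorem volterraFun_apply (i : Fin d) (σ : Curve d k) (f : Path N) (t : unitInterval) :
    volterraFun i σ f t = ∫ s in (0 : ℝ)..t, velocity σ s i • ext f s := rfl

theorem norm_integral_velocity_smul_le (i : Fin d) (σ : Curve d k) (f : Path N)
    {t : ℝ} (ht : t ∈ Icc (0 : ℝ) 1) :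
    ‖∫ s in (0 : ℝ)..t, velocity σ s i • ext f s‖
      ≤ ∫ s in (0 : ℝ)..t, ‖velocity σ s i‖ * ‖ext f s‖ := by
  refine (intervalIntegral.norm_integral_le_integral_norm ht.1).trans_eq ?_
  simp only [norm_smul]

/-- The bilinear operator `(σ, f) ↦ (t ↦ ∫_0^t (dσ^i/ds) f(s) ds)`. -/
noncomputable def volterra (i : Fin d) : Curve d k →L[ℝ] Path N →L[ℝ] Path N :=
  LinearMap.mkContinuous₂
    (LinearMap.mk₂ ℝ (volterraFun i)
      (fun σ τ f => by
        ext1 t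
        rw [ContinuousMap.add_apply]
        simp only [volterraFun_apply]
        rw [← intervalIntegral.integral_add
          (intervalIntegrable_of_unit
            (integrable_velocity_smul σ i (continuous_ext f)) (by simp) t.2)
          (intervalIntegrable_of_unit
            (integrable_velocity_smul τ i (continuous_ext f)) (by simp) t.2)]
        refine integral_unit_congr ?_ (by simp) t.2
        filter_upwards [velocity_add σ τ] with s hs
        rw [hs, PiLp.add_apply, add_smul])
      (fun c σ f => by
        ext1 t
        rw [ContinuousMap.smul_apply]
        simp only [volterraFun_apply]
        rw [← intervalIntegral.integral_smul]
        refine integral_unit_congr ?_ (by simp) t.2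
        filter_upwards [velocity_smul c σ] with s hs
        rw [hs, PiLp.smul_apply, smul_assoc])
      (fun σ f g => by
        ext1 t
        rw [ContinuousMap.add_apply]
        simp only [volterraFun_apply]
        rw [← intervalIntegral.integral_add
          (intervalIntegrable_of_unit
            (integrable_velocity_smul σ i (continuous_ext f)) (by simp) t.2)
          (intervalIntegrable_of_unit
            (integrable_velocity_smul σ i (continuous_ext g)) (by simp) t.2)]
        simp only [ext_add, smul_add])
      (fun c σ f => by
        ext1 t
        rw [ContinuousMap.smul_apply]
        simp only [volterraFun_apply]
        rw [← intervalIntegral.integral_smul]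
        refine integral_unit_congr (Eventually.of_forall fun s => ?_) (by simp) t.2
        exact smul_comm _ c (ext f s)))
    1 (fun σ f => by
      rw [one_mul, ContinuousMap.norm_le _ (by positivity)]
      intro t
      refine (norm_integral_velocity_smul_le i σ f t.2).trans ?_
      have h1 := integrable_velocity_apply σ i
      have h2 : ∫ s in (0 : ℝ)..t, ‖velocity σ s i‖ * ‖ext f s‖
          ≤ ∫ s in (0 : ℝ)..t, ‖velocity σ s i‖ * ‖f‖ := by
        refine intervalIntegral.integral_mono_on t.2.1 ?_ ?_ fun s _ =>
          mul_le_mul_of_nonneg_left (norm_ext_le f s) (norm_nonneg _)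
        · have h := (integrable_velocity_smul σ i (continuous_ext f)).norm
          simp only [norm_smul] at h
          exact intervalIntegrable_of_unit h (by simp) t.2
        · exact intervalIntegrable_of_unit (h1.norm.mul_const _) (by simp) t.2
      refine h2.trans ?_
      rw [intervalIntegral.integral_mul_const]
      refine mul_le_mul_of_nonneg_right (le_trans ?_ (integral_norm_velocity_apply_le σ i))
        (norm_nonneg _)
      rw [intervalIntegral.integral_of_le t.2.1]
      exact setIntegral_mono_set h1.norm (Eventually.of_forall fun s => norm_nonneg _)
        (Ioc_subset_unit t).eventuallyLE)

theorem ext_volterra (i : Fin d) (σ : Curve d k) (f : Path N) {t : ℝ} (ht : t ∈ Icc (0 : ℝ) 1) :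
    ext (volterra i σ f) t = ∫ s in (0 : ℝ)..t, velocity σ s i • ext f s := by
  rw [ext, Set.projIcc_of_mem zero_le_one ht]
  rfl

theorem ext_volterra_zero (i : Fin d) (σ : Curve d k) (f : Path N) :
    ext (volterra i σ f) 0 = 0 := by
  rw [ext_volterra i σ f (by simp)]; simp

theorem isPrimitive_volterra (i : Fin d) (σ : Curve d k) (f : Path N) :
    IsPrimitive (ext (volterra i σ f)) (fun t => velocity σ t i • ext f t) :=
  IsPrimitive.of_integral (integrable_velocity_smul σ i (continuous_ext f)) 0 fun t ht => by
    rw [ext_volterra i σ f ht, zero_add]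

/-- The coordinate `σ ↦ σ^i`, as a path of scalar matrices. -/
noncomputable def coord (i : Fin d) : Curve d k →L[ℝ] Path N :=
  LinearMap.mkContinuous
    { toFun := fun σ => ⟨fun t => (σ.1.1 t i) • (1 : Mat N), by
        have : Continuous fun t => σ.1.1 t i :=
          (EuclideanSpace.proj (𝕜 := ℝ) i).continuous.comp σ.1.1.continuous
        fun_prop⟩
      map_add' := fun σ τ => by
        ext1 t
        change (σ.1.1 t i + τ.1.1 t i) • (1 : Mat N) = _
        rw [add_smul]; rfl
      map_smul' := fun c σ => by
        ext1 t
        change (c • σ.1.1 t i) • (1 : Mat N) = _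
        rw [smul_assoc]; rfl } ‖(1 : Mat N)‖ fun σ => by
      rw [ContinuousMap.norm_le _ (by positivity)]
      intro t
      change ‖(σ.1.1 t i) • (1 : Mat N)‖ ≤ _
      rw [norm_smul, mul_comm]
      refine mul_le_mul_of_nonneg_left ?_ (norm_nonneg _)
      refine (PiLp.norm_apply_le _ i).trans ((σ.1.1.norm_coe_le_norm t).trans ?_)
      exact norm_fst_le (σ.1 : C(unitInterval, Space d) × VelocitySpace d k)

theorem ext_coord (i : Fin d) (σ : Curve d k) (t : ℝ) :
    ext (coord (N := N) i σ) t = position σ t i • 1 := rfl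

/-! ### Pull-back of functions along curves -/

theorem _root_.ContDiff.partialDeriv {Φ : Space d → Mat N} (hΦ : ContDiff ℝ ∞ Φ) (i : Fin d) :
    ContDiff ℝ ∞ (partialDeriv i Φ) :=
  (hΦ.fderiv_right (m := ∞) (by simp)).clm_apply contDiff_const

theorem fderiv_eq_sum_partialDeriv (Φ : Space d → Mat N) (x v : Space d) :
    fderiv ℝ Φ x v = ∑ i, v i • partialDeriv i Φ x := by
  have h : v = ∑ i, v i • EuclideanSpace.single i (1 : ℝ) := by
    ext j; simp [Finset.sum_apply, Pi.single_apply]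
  conv_lhs => rw [h]
  simp only [map_sum, map_smul, partialDeriv]

/-- The path `t ↦ Φ(σ(t))`. -/
noncomputable def pullback (Φ : Space d → Mat N) (hΦ : ContDiff ℝ ∞ Φ) (σ : Curve d k) : Path N :=
  ⟨fun t => Φ (σ.1.1 t), hΦ.continuous.comp σ.1.1.continuous⟩

theorem ext_pullback {Φ : Space d → Mat N} (hΦ : ContDiff ℝ ∞ Φ) (σ : Curve d k) (t : ℝ) :
    ext (pullback Φ hΦ σ) t = Φ (position σ t) := rfl

theorem isPrimitive_pullback {Φ : Space d → Mat N} (hΦ : ContDiff ℝ ∞ Φ) (σ : Curve d k) :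
    IsPrimitive (ext (pullback Φ hΦ σ))
      (fun t => ∑ i, velocity σ t i • partialDeriv i Φ (position σ t)) := by
  refine ((isPrimitive_position σ).comp (hΦ.of_le (by simp))).congr fun t _ => ?_
  rw [fderiv_eq_sum_partialDeriv]

/-- The derivative of `σ ↦ Φ ∘ σ`. -/
noncomputable def pullbackDeriv {Φ : Space d → Mat N} (hΦ : ContDiff ℝ ∞ Φ) (σ : Curve d k) :
    Curve d k →L[ℝ] Path N :=
  ∑ i, ((ContinuousLinearMap.mul ℝ (Path N)).flip
    (pullback (partialDeriv i Φ) (hΦ.partialDeriv i) σ)).comp (coord i)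

theorem pullbackDeriv_apply {Φ : Space d → Mat N} (hΦ : ContDiff ℝ ∞ Φ) (σ w : Curve d k) :
    pullbackDeriv hΦ σ w
      = ∑ i, coord i w * pullback (partialDeriv i Φ) (hΦ.partialDeriv i) σ := by
  simp [pullbackDeriv]

/-- The first-order remainder must be small uniformly in `t`. The range of `σ` is compact, so
`fderiv ℝ Φ` is uniformly continuous at its points, and the mean value inequality on a ball around
each `σ(t)` gives the estimate. -/
theorem hasFDerivAt_pullback {Φ : Space d → Mat N} (hΦ : ContDiff ℝ ∞ Φ) (σ : Curve d k) :
    HasFDerivAt (pullback Φ hΦ) (pullbackDeriv hΦ σ) σ := by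
  rw [hasFDerivAt_iff_isLittleO_nhds_zero, Asymptotics.isLittleO_iff]
  intro ε hε
  have hc : IsCompact (range σ.1.1) := isCompact_range σ.1.1.continuous
  have hu := hc.uniformContinuousAt_of_continuousAt (fderiv ℝ Φ)
    (fun x _ => (hΦ.continuous_fderiv (by simp)).continuousAt) (Metric.dist_mem_uniformity hε)
  obtain ⟨δ, hδ, H⟩ := Metric.mem_uniformity_dist.1 hu
  filter_upwards [Metric.ball_mem_nhds (0 : Curve d k) hδ] with w hw
  rw [mem_ball_zero_iff] at hw
  rw [ContinuousMap.norm_le _ (by positivity)]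
  intro t
  have hwt : ‖w.1.1 t‖ ≤ ‖w‖ := (w.1.1.norm_coe_le_norm t).trans
    (norm_fst_le (w.1 : C(unitInterval, Space d) × VelocitySpace d k))
  have hval : (pullback Φ hΦ (σ + w) - pullback Φ hΦ σ - pullbackDeriv hΦ σ w) t
      = Φ (σ.1.1 t + w.1.1 t) - Φ (σ.1.1 t) - fderiv ℝ Φ (σ.1.1 t) (w.1.1 t) := by
    rw [fderiv_eq_sum_partialDeriv, pullbackDeriv_apply]
    simp only [ContinuousMap.sub_apply, ContinuousMap.coe_sum, Finset.sum_apply,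
      ContinuousMap.mul_apply]
    congr 1
    refine Finset.sum_congr rfl fun i _ => ?_
    change (w.1.1 t i • (1 : Mat N)) * _ = _
    rw [smul_mul_assoc, one_mul]; rfl
  rw [hval]
  have hmv := (convex_ball (σ.1.1 t) δ).norm_image_sub_le_of_norm_fderiv_le' (𝕜 := ℝ) (f := Φ)
    (φ := fderiv ℝ Φ (σ.1.1 t)) (C := ε)
    (fun x _ => (hΦ.differentiable (by simp)).differentiableAt)
    (fun x hx => by
      have := H (a := σ.1.1 t) (b := x) (by rwa [dist_comm]) (mem_range_self t)
      rw [← dist_eq_norm, dist_comm]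
      exact (mem_ofPred_eq ▸ this : _).le)
    (Metric.mem_ball_self hδ) (y := σ.1.1 t + w.1.1 t)
    (by rw [Metric.mem_ball, dist_eq_norm, add_sub_cancel_left]; exact hwt.trans_lt hw)
  rw [add_sub_cancel_left] at hmv
  exact hmv.trans (mul_le_mul_of_nonneg_left hwt hε.le)

/-- Induction over all smooth `Φ` at once: the derivative is a finite sum of pull-backs of partial
derivatives composed with fixed continuous linear operations. -/
theorem contDiff_pullback {Φ : Space d → Mat N} (hΦ : ContDiff ℝ ∞ Φ) :
    ContDiff ℝ ∞ (pullback Φ hΦ : Curve d k → Path N) := by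
  rw [contDiff_infty]
  intro n
  induction n generalizing Φ with
  | zero =>
    exact contDiff_zero.2 (continuous_iff_continuousAt.2 fun σ =>
      (hasFDerivAt_pullback hΦ σ).continuousAt)
  | succ n ih =>
    refine contDiff_succ_iff_hasFDerivAt.2 ⟨_, ?_, hasFDerivAt_pullback hΦ⟩
    refine ContDiff.sum fun i _ => ContDiff.clm_comp ?_ contDiff_const
    exact (ContinuousLinearMap.contDiff _).comp (ih (hΦ.partialDeriv i))

/-! ### Volterra operators are quasi-nilpotent -/

/-- `1 - x ^ n` is the product of `1 - x` and a geometric sum commuting with it, and a commuting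
factor of a unit is a unit. -/
theorem isUnit_one_sub_of_isUnit_one_sub_pow {R : Type*} [Ring R] {x : R} {n : ℕ}
    (h : IsUnit (1 - x ^ n)) : IsUnit (1 - x) := by
  have hcomm : Commute (1 - x) (∑ i ∈ Finset.range n, x ^ i) :=
    Commute.sum_right _ _ _ fun i _ => (Commute.one_left _).sub_left (Commute.self_pow _ _)
  rw [← mul_neg_geom_sum, hcomm.isUnit_mul_iff] at h
  exact h.1

/-- With `α(t) = ∫_0^t ρ`, iterating the hypothesis bounds `‖(S ^ n) f‖` at time `t` by `α(t)^n / n!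
* ‖f‖`. Some power of `S` therefore has norm below `1`, whatever the size of `S` itself. -/
theorem isUnit_one_sub_of_norm_le_integral (S : Path N →L[ℝ] Path N) {ρ : ℝ → ℝ}
    (hρ : Integrable ρ unitMeasure) (hρ0 : ∀ t, 0 ≤ ρ t)
    (hT : ∀ f : Path N, ∀ t ∈ Icc (0 : ℝ) 1,
      ‖ext (S f) t‖ ≤ ∫ s in (0 : ℝ)..t, ρ s * ‖ext f s‖) : IsUnit (1 - S) := by
  set α : ℝ → ℝ := fun t => ∫ s in (0 : ℝ)..t, ρ s with hα
  have hprim : IsPrimitive α ρ := IsPrimitive.of_integral hρ 0 fun t _ => by simp [hα]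
  have hα0 : α 0 = 0 := by simp [hα]
  have key : ∀ n : ℕ, ∀ f : Path N, ∀ t ∈ Icc (0 : ℝ) 1,
      ‖ext ((S ^ n) f) t‖ ≤ α t ^ n / n.factorial * ‖f‖ := by
    intro n
    induction n with
    | zero => intro f t _; simpa using norm_ext_le f t
    | succ n ih =>
      intro f t ht
      have hsub : ∀ s ∈ Icc (0 : ℝ) t, s ∈ Icc (0 : ℝ) 1 := fun s hs => ⟨hs.1, hs.2.trans ht.2⟩
      -- The inductive step integrates the bound exactly: `ρ α^n / n!` is the a.e. derivative of
      -- `α^(n+1) / (n+1)!`.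
      have hpow : IsPrimitive (fun t => α t ^ (n + 1) / (n + 1).factorial)
          (fun t => ρ t * (α t ^ n / n.factorial)) := by
        refine (hprim.comp (Φ := fun x : ℝ => x ^ (n + 1) / (n + 1).factorial)
          (by fun_prop)).congr fun t _ => ?_
        have hd : HasDerivAt (fun x : ℝ => x ^ (n + 1) / (n + 1).factorial)
            (α t ^ n / n.factorial) (α t) := by
          refine ((hasDerivAt_pow (n + 1) (α t)).div_const _).congr_deriv ?_
          rw [Nat.factorial_succ]; push_cast; field_simp
        rw [hd.hasFDerivAt.fderiv]
        simp
      rw [pow_succ']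
      refine (hT _ t ht).trans ?_
      have h1 : ∫ s in (0 : ℝ)..t, ρ s * ‖ext ((S ^ n) f) s‖
          ≤ ∫ s in (0 : ℝ)..t, (ρ s * (α s ^ n / n.factorial)) * ‖f‖ := by
        refine intervalIntegral.integral_mono_on ht.1 ?_ ?_ fun s hs => ?_
        · refine intervalIntegrable_of_unit ?_ (by simp) ht
          have h : IntegrableOn ρ (Icc 0 1) := hρ
          exact h.mul_continuousOn (continuous_ext _).norm.continuousOn isCompact_Icc
        · exact intervalIntegrable_of_unit (hpow.integrable.mul_const _) (by simp) ht
        · rw [mul_assoc]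
          exact mul_le_mul_of_nonneg_left (ih f s (hsub s hs)) (hρ0 s)
      refine h1.trans_eq ?_
      rw [intervalIntegral.integral_mul_const, hpow.integral_eq (by simp) ht, hα0]
      simp
  have hmono : ∀ t ∈ Icc (0 : ℝ) 1, 0 ≤ α t ∧ α t ≤ α 1 := by
    intro t ht
    have h1 : 0 ≤ α t := intervalIntegral.integral_nonneg ht.1 fun s _ => hρ0 s
    have h2 : α 1 - α t = ∫ s in t..1, ρ s := (hprim.integral_eq ht (by simp)).symm
    have h3 : 0 ≤ ∫ s in t..1, ρ s := intervalIntegral.integral_nonneg ht.2 fun s _ => hρ0 s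
    exact ⟨h1, by linarith⟩
  have hnorm : ∀ n : ℕ, ‖S ^ n‖ ≤ α 1 ^ n / n.factorial := by
    intro n
    have h1 := hmono 1 (by simp)
    have h1n : (0 : ℝ) ≤ α 1 ^ n / n.factorial := by have := h1.1; positivity
    refine ContinuousLinearMap.opNorm_le_bound _ h1n fun f => ?_
    rw [ContinuousMap.norm_le _ (by positivity)]
    intro t
    rw [← ext_coe]
    refine (key n f t t.2).trans ?_
    have := hmono t t.2
    gcongr
    · exact this.1
    · exact this.2
  have hlim := (FloorSemiring.tendsto_pow_div_factorial_atTop (α 1))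
  obtain ⟨n, hn⟩ := (hlim.eventually (gt_mem_nhds (zero_lt_one' ℝ))).exists
  have hu : IsUnit (1 - S ^ n) := isUnit_one_sub_of_norm_lt_one (R := Path N →L[ℝ] Path N) ((hnorm n).trans_lt hn)
  exact isUnit_one_sub_of_isUnit_one_sub_pow (R := Path N →L[ℝ] Path N) hu

end Curves

/-! ### The parallel transport -/

section Transport

variable {d N : ℕ} {k : CurveClass}

theorem isUnit_one_sub_sum_volterra (σ : Curve d k) (T : Fin d → Path N →L[ℝ] Path N)
    (C : Fin d → ℝ) (hC : ∀ i, 0 ≤ C i)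
    (hT : ∀ i f t, ‖ext (T i f) t‖ ≤ C i * ‖ext f t‖) :
    IsUnit (1 - ∑ i, (volterra i σ).comp (T i)) := by
  have hi : ∀ i, Integrable (fun s => ‖velocity σ s i‖ * C i) unitMeasure := fun i =>
    (integrable_velocity_apply σ i).norm.mul_const _
  refine isUnit_one_sub_of_norm_le_integral _ (ρ := fun s => ∑ i, ‖velocity σ s i‖ * C i)
    (integrable_finsetSum _ fun i _ => hi i)
    (fun t => Finset.sum_nonneg fun i _ => mul_nonneg (norm_nonneg _) (hC i)) fun f t ht => ?_
  have hint : ∀ i, IntervalIntegrable (fun s => ‖velocity σ s i‖ * C i * ‖ext f s‖)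
      volume 0 t := by
    intro i
    refine intervalIntegrable_of_unit ?_ (by simp) ht
    have h : IntegrableOn (fun s => ‖velocity σ s i‖ * C i) (Icc 0 1) := hi i
    exact h.mul_continuousOn (continuous_ext f).norm.continuousOn isCompact_Icc
  simp only [Finset.sum_mul]
  rw [intervalIntegral.integral_finsetSum fun i _ => hint i]
  have e : (∑ i, (volterra i σ).comp (T i)) f = ∑ i, volterra i σ (T i f) := by simp
  rw [e, ext_sum]
  refine (norm_sum_le _ _).trans (Finset.sum_le_sum fun i _ => ?_)
  rw [ext_volterra i σ _ ht]
  refine (norm_integral_velocity_smul_le i σ _ ht).trans ?_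
  refine intervalIntegral.integral_mono_on ht.1 ?_ (hint i) fun s _ => ?_
  · have h := (integrable_velocity_smul σ i (continuous_ext (T i f))).norm
    simp only [norm_smul] at h
    exact intervalIntegrable_of_unit h (by simp) ht
  · rw [mul_assoc]
    exact mul_le_mul_of_nonneg_left (hT i f s) (norm_nonneg _)

theorem apply_one_inverse_one_sub {S : Path N →L[ℝ] Path N} (hS : IsUnit (1 - S)) :
    Ring.inverse (1 - S) 1 = 1 + S (Ring.inverse (1 - S) 1) := by
  have h := congrArg (fun T : Path N →L[ℝ] Path N => T 1) (Ring.mul_inverse_cancel _ hS)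
  change (1 - S) (Ring.inverse (1 - S) 1) = 1 at h
  rw [sub_apply, one_apply_eq_self] at h
  exact sub_eq_iff_eq_add.1 h

variable {A : Fin d → Space d → Mat N}

/-- The integral operator `f ↦ -∫ A_μ(σ) σ'^μ f`. -/
noncomputable def transportOp (hA : ∀ μ, ContDiff ℝ ∞ (A μ)) (σ : Curve d k) :
    Path N →L[ℝ] Path N :=
  ∑ i, (volterra i σ).comp (-(ContinuousLinearMap.mul ℝ (Path N) (pullback (A i) (hA i) σ)))

/-- The integral operator `f ↦ ∫ f A_μ(σ) σ'^μ`. -/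
noncomputable def cotransportOp (hA : ∀ μ, ContDiff ℝ ∞ (A μ)) (σ : Curve d k) :
    Path N →L[ℝ] Path N :=
  ∑ i, (volterra i σ).comp ((ContinuousLinearMap.mul ℝ (Path N)).flip (pullback (A i) (hA i) σ))

/-- The path `t ↦ U_{t,0}(σ)`. -/
noncomputable def transport (hA : ∀ μ, ContDiff ℝ ∞ (A μ)) (σ : Curve d k) : Path N :=
  Ring.inverse (1 - transportOp hA σ) 1

/-- The path `t ↦ U_{0,t}(σ)`. -/
noncomputable def cotransport (hA : ∀ μ, ContDiff ℝ ∞ (A μ)) (σ : Curve d k) : Path N :=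
  Ring.inverse (1 - cotransportOp hA σ) 1

variable (hA : ∀ μ, ContDiff ℝ ∞ (A μ))

theorem isUnit_one_sub_transportOp (σ : Curve d k) : IsUnit (1 - transportOp hA σ) := by
  refine isUnit_one_sub_sum_volterra σ _ (fun i => ‖pullback (A i) (hA i) σ‖)
    (fun i => norm_nonneg _) fun i f t => ?_
  change ‖-(ext (pullback (A i) (hA i) σ) t * ext f t)‖ ≤ _
  rw [norm_neg]
  exact (norm_mul_le _ _).trans
    (mul_le_mul_of_nonneg_right (norm_ext_le _ _) (norm_nonneg _))

theorem isUnit_one_sub_cotransportOp (σ : Curve d k) : IsUnit (1 - cotransportOp hA σ) := by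
  refine isUnit_one_sub_sum_volterra σ _ (fun i => ‖pullback (A i) (hA i) σ‖)
    (fun i => norm_nonneg _) fun i f t => ?_
  change ‖ext f t * ext (pullback (A i) (hA i) σ) t‖ ≤ _
  rw [mul_comm ‖_‖ ‖_‖]
  exact (norm_mul_le _ _).trans
    (mul_le_mul_of_nonneg_left (norm_ext_le _ _) (norm_nonneg _))

theorem transport_eq (σ : Curve d k) :
    transport hA σ = 1 - ∑ i, volterra i σ (pullback (A i) (hA i) σ * transport hA σ) := by
  have h := apply_one_inverse_one_sub (isUnit_one_sub_transportOp hA σ)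
  refine h.trans ?_
  simp [transportOp, transport, sub_eq_add_neg]

theorem cotransport_eq (σ : Curve d k) :
    cotransport hA σ = 1 + ∑ i, volterra i σ (cotransport hA σ * pullback (A i) (hA i) σ) := by
  have h := apply_one_inverse_one_sub (isUnit_one_sub_cotransportOp hA σ)
  refine h.trans ?_
  simp [cotransportOp, cotransport]

theorem ext_transport_zero (σ : Curve d k) : ext (transport hA σ) 0 = 1 := by
  rw [transport_eq, ext_sub, ext_sum]
  simp [ext_volterra_zero, ext_one]

theorem ext_cotransport_zero (σ : Curve d k) : ext (cotransport hA σ) 0 = 1 := by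
  rw [cotransport_eq, ext_add, ext_sum]
  simp [ext_volterra_zero, ext_one]

theorem isPrimitive_transport (σ : Curve d k) :
    IsPrimitive (ext (transport hA σ)) (fun t => -(alongCurve A σ t * ext (transport hA σ) t)) := by
  have h := (IsPrimitive.const (1 : Mat N)).sub (IsPrimitive.sum (s := Finset.univ) fun i _ =>
    isPrimitive_volterra i σ (pullback (A i) (hA i) σ * transport hA σ))
  have e : (fun t => (1 : Mat N) - ∑ i, ext (volterra i σ
      (pullback (A i) (hA i) σ * transport hA σ)) t) = ext (transport hA σ) := by
    conv_rhs => rw [transport_eq]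
    ext1 t
    rw [ext_sub, ext_sum, ext_one]
  rw [e] at h
  refine h.congr fun t _ => ?_
  simp only [ext_mul, ext_pullback, alongCurve, Finset.sum_mul, smul_mul_assoc, zero_sub]

theorem isPrimitive_cotransport (σ : Curve d k) :
    IsPrimitive (ext (cotransport hA σ)) (fun t => ext (cotransport hA σ) t * alongCurve A σ t) := by
  have h := (IsPrimitive.const (1 : Mat N)).add (IsPrimitive.sum (s := Finset.univ) fun i _ =>
    isPrimitive_volterra i σ (cotransport hA σ * pullback (A i) (hA i) σ))
  have e : (fun t => (1 : Mat N) + ∑ i, ext (volterra i σ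
      (cotransport hA σ * pullback (A i) (hA i) σ)) t) = ext (cotransport hA σ) := by
    conv_rhs => rw [cotransport_eq]
    ext1 t
    rw [ext_add, ext_sum, ext_one]
  rw [e] at h
  refine h.congr fun t _ => ?_
  simp only [ext_mul, ext_pullback, alongCurve, Finset.mul_sum, mul_smul_comm, zero_add]

/-- The two evolution equations have opposite signs, so the derivative of the product vanishes and
its initial value is `1`. -/
theorem cotransport_mul_transport (σ : Curve d k) : cotransport hA σ * transport hA σ = 1 := by
  refine path_ext fun t ht => ?_
  have h := (isPrimitive_cotransport hA σ).mul (isPrimitive_transport hA σ)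
  exact h.eqOn (IsPrimitive.const 1) (Eventually.of_forall fun s => by noncomm_ring)
    (by simp [ext_transport_zero, ext_cotransport_zero]) ht

theorem transport_mul_cotransport (σ : Curve d k) : transport hA σ * cotransport hA σ = 1 := by
  ext1 t
  have h := congrArg (fun f : Path N => f t) (cotransport_mul_transport hA σ)
  -- Pointwise these are square matrices, for which a left inverse is a right inverse.
  exact mul_eq_one_comm.1 h

theorem ext_cotransport_mul_transport (σ : Curve d k) (t : ℝ) :
    ext (cotransport hA σ) t * ext (transport hA σ) t = 1 := by
  rw [← ext_mul, cotransport_mul_transport, ext_one]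

theorem ext_transport_mul_cotransport (σ : Curve d k) (t : ℝ) :
    ext (transport hA σ) t * ext (cotransport hA σ) t = 1 := by
  rw [← ext_mul, transport_mul_cotransport, ext_one]

theorem isParallelTransport_transport (σ : Curve d k) : IsParallelTransport A σ
    fun t s => ext (transport hA σ) t * ext (cotransport hA σ) s where
  continuousOn_left s _ := ((continuous_ext _).mul continuous_const).continuousOn
  continuousOn_right t _ := (continuous_const.mul (continuous_ext _)).continuousOn
  left_eq s t hs hst ht := by
    have h := ((isPrimitive_transport hA σ).mul
      (IsPrimitive.const (ext (cotransport hA σ) s))).neg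
    have h2 := (h.congr (q := fun r => alongCurve A σ r *
      (ext (transport hA σ) r * ext (cotransport hA σ) s)) fun r _ => by noncomm_ring).integral_eq
      (s := s) (t := t) ⟨hs, hst.trans ht⟩ ⟨hs.trans hst, ht⟩
    rw [h2, ext_transport_mul_cotransport]
    abel
  right_eq s t hs hst ht := by
    have h := (IsPrimitive.const (ext (transport hA σ) t)).mul (isPrimitive_cotransport hA σ)
    have h2 := (h.congr (q := fun r => ext (transport hA σ) t * ext (cotransport hA σ) r *
      alongCurve A σ r) fun r _ => by noncomm_ring).integral_eq
      (s := s) (t := t) ⟨hs, hst.trans ht⟩ ⟨hs.trans hst, ht⟩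
    rw [h2, ext_transport_mul_cotransport]
    abel
  inverse s t _ _ _ := by
    refine (Matrix.inv_eq_left_inv ?_).symm
    rw [mul_assoc, ← mul_assoc (ext (cotransport hA σ) t), ext_cotransport_mul_transport, one_mul,
      ext_transport_mul_cotransport]

variable (A) in
theorem integrable_alongCurve (hA : ∀ μ, ContDiff ℝ ∞ (A μ)) (σ : Curve d k) : Integrable (alongCurve A σ) unitMeasure :=
  integrable_finsetSum _ fun i _ =>
    integrable_velocity_smul σ i ((hA i).continuous.comp (continuous_position σ))

variable (A) in
theorem isParallelTransport_parallelTransport (hA : ∀ μ, ContDiff ℝ ∞ (A μ)) (σ : Curve d k) :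
    IsParallelTransport A σ fun t s => parallelTransport A t s σ :=
  Classical.epsilon_spec (p := IsParallelTransport A σ) ⟨_, isParallelTransport_transport hA σ⟩

/-- `parallelTransport` is a chosen solution, so uniqueness is needed to identify it: `Z_t` times
any solution started at `1` has zero derivative, hence equals `1`. -/
theorem parallelTransport_zero_right (σ : Curve d k) {t : ℝ} (ht : t ∈ Icc (0 : ℝ) 1) :
    parallelTransport A t 0 σ = ext (transport hA σ) t := by
  have hU := isParallelTransport_parallelTransport A hA σ
  have hc := hU.continuousOn_left 0 (by simp)
  have hp : IsPrimitive (fun t => parallelTransport A t 0 σ)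
      (fun t => -(alongCurve A σ t * parallelTransport A t 0 σ)) := by
    have hi : IntegrableOn (alongCurve A σ) (Icc 0 1) := integrable_alongCurve A hA σ
    refine IsPrimitive.of_integral (hi.mul_continuousOn hc isCompact_Icc).neg 1 fun s hs => ?_
    rw [hU.left_eq 0 s le_rfl hs.1 hs.2, intervalIntegral.integral_neg, sub_eq_add_neg]
  have h0 : parallelTransport A 0 0 σ = 1 := by
    rw [hU.left_eq 0 0 le_rfl le_rfl zero_le_one]; simp
  have h := (isPrimitive_cotransport hA σ).mul hp
  have h1 := h.eqOn (IsPrimitive.const 1) (Eventually.of_forall fun s => by noncomm_ring)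
    (by simp [h0, ext_cotransport_zero]) ht
  calc parallelTransport A t 0 σ
      = ext (transport hA σ) t * (ext (cotransport hA σ) t * parallelTransport A t 0 σ) := by
        rw [← mul_assoc, ext_transport_mul_cotransport, one_mul]
    _ = _ := by rw [h1, mul_one]

theorem parallelTransport_zero_left (σ : Curve d k) {t : ℝ} (ht : t ∈ Icc (0 : ℝ) 1) :
    parallelTransport A 0 t σ = ext (cotransport hA σ) t := by
  rw [(isParallelTransport_parallelTransport A hA σ).inverse 0 t le_rfl ht.1 ht.2,
    parallelTransport_zero_right hA σ ht]
  exact Matrix.inv_eq_left_inv (ext_cotransport_mul_transport hA σ t)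

/-! ### Smoothness of the parallel transport -/

/-- The operator depends smoothly on `σ` because velocities enter linearly and `A` through
pull-backs; inversion is smooth at units of the algebra of bounded operators. -/
theorem contDiff_transport : ContDiff ℝ ∞ (transport hA : Curve d k → Path N) := by
  have hS : ContDiff ℝ ∞ (transportOp hA : Curve d k → Path N →L[ℝ] Path N) := by
    refine ContDiff.sum fun i _ => (ContinuousLinearMap.contDiff _).clm_comp (ContDiff.neg ?_)
    exact (ContinuousLinearMap.contDiff _).comp (contDiff_pullback (hA i))
  refine ContDiff.clm_apply (contDiff_iff_contDiffAt.2 fun σ => ?_) contDiff_const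
  obtain ⟨u, hu⟩ := isUnit_one_sub_transportOp hA σ
  have h := contDiffAt_ringInverse ℝ (R := Path N →L[ℝ] Path N) (n := ∞) u
  rw [hu] at h
  exact h.comp σ (contDiff_const.sub hS).contDiffAt

theorem cotransport_eq_inverse (σ : Curve d k) :
    cotransport hA σ = Ring.inverse (transport hA σ) :=
  (Ring.inverse_unit (⟨_, _, transport_mul_cotransport hA σ, cotransport_mul_transport hA σ⟩ :
    (Path N)ˣ)).symm

theorem contDiff_cotransport : ContDiff ℝ ∞ (cotransport hA : Curve d k → Path N) := by
  have e : (cotransport hA : Curve d k → Path N) = fun σ => Ring.inverse (transport hA σ) :=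
    funext (cotransport_eq_inverse hA)
  rw [e, contDiff_iff_contDiffAt]
  intro σ
  have h := contDiffAt_ringInverse ℝ (n := ∞) (⟨_, _, transport_mul_cotransport hA σ,
    cotransport_mul_transport hA σ⟩ : (Path N)ˣ)
  exact h.comp σ (contDiff_transport hA).contDiffAt

end Transport

/-! ### Derivatives of the parallel transport -/

section Derivatives

variable {d N : ℕ} {k : CurveClass} {A : Fin d → Space d → Mat N}

theorem contDiff_covDeriv (hA : ∀ μ, ContDiff ℝ ∞ (A μ)) (l : Fin d) {Φ : Space d → Mat N}
    (hΦ : ContDiff ℝ ∞ Φ) : ContDiff ℝ ∞ (covDeriv A l Φ) :=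
  (hΦ.partialDeriv l).add (((hA l).mul hΦ).sub (hΦ.mul (hA l)))

theorem contDiff_curvature (hA : ∀ μ, ContDiff ℝ ∞ (A μ)) (μ ν : Fin d) :
    ContDiff ℝ ∞ (curvature A μ ν) :=
  (((hA ν).partialDeriv μ).sub ((hA μ).partialDeriv ν)).add
    (((hA μ).mul (hA ν)).sub ((hA ν).mul (hA μ)))

variable (hA : ∀ μ, ContDiff ℝ ∞ (A μ))

/-- The path `t ↦ U_{0,t}(σ) Φ(σ(t)) U_{t,0}(σ)`. -/
noncomputable def frame {Φ : Space d → Mat N} (hΦ : ContDiff ℝ ∞ Φ) (σ : Curve d k) : Path N :=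
  cotransport hA σ * pullback Φ hΦ σ * transport hA σ

theorem ext_frame {Φ : Space d → Mat N} (hΦ : ContDiff ℝ ∞ Φ) (σ : Curve d k) (t : ℝ) :
    ext (frame hA hΦ σ) t
      = ext (cotransport hA σ) t * Φ (position σ t) * ext (transport hA σ) t := rfl

/-- The derivatives of the outer factors `Z` and `W` contribute exactly the commutator with `A_i`
that turns `∂_i Φ` into `∇_i Φ`. -/
theorem isPrimitive_frame {Φ : Space d → Mat N} (hΦ : ContDiff ℝ ∞ Φ) (σ : Curve d k) :
    IsPrimitive (ext (frame hA hΦ σ))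
      (fun t => ∑ i, velocity σ t i • ext (frame hA (contDiff_covDeriv hA i hΦ) σ) t) := by
  refine (((isPrimitive_cotransport hA σ).mul (isPrimitive_pullback hΦ σ)).mul
    (isPrimitive_transport hA σ)).congr fun t _ => ?_
  simp only [ext_frame, ext_pullback, alongCurve, covDeriv, Finset.mul_sum, Finset.sum_mul,
    ← Finset.sum_add_distrib, mul_neg, ← Finset.sum_neg_distrib]
  refine Finset.sum_congr rfl fun i _ => ?_
  simp only [smul_mul_assoc, mul_smul_comm, ← smul_neg, ← smul_add]
  congr 1
  noncomm_ring

theorem ext_coord_mul (i : Fin d) (w : Curve d k) (f : Path N) (t : ℝ) :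
    ext (coord i w * f) t = position w t i • ext f t := by
  rw [ext_mul, ext_coord, smul_mul_assoc, one_mul]

/-- The path `t ↦ ∫_0^t U_{0,s} F_{μν}(σ(s)) w^μ(s) σ'^ν(s) U_{s,0} ds`. -/
noncomputable def curvatureForm (σ w : Curve d k) : Path N :=
  ∑ μ, ∑ ν, volterra ν σ (coord μ w * frame hA (contDiff_curvature hA μ ν) σ)

theorem isPrimitive_curvatureForm (σ w : Curve d k) :
    IsPrimitive (ext (curvatureForm hA σ w)) (fun t => ∑ μ, ∑ ν,
      (position w t μ * velocity σ t ν) • ext (frame hA (contDiff_curvature hA μ ν) σ) t) := by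
  have h := IsPrimitive.sum (s := Finset.univ) fun μ _ => IsPrimitive.sum (s := Finset.univ)
    fun ν _ => isPrimitive_volterra ν σ
      (coord μ w * frame hA (contDiff_curvature hA μ ν) σ)
  have e : (fun t => ∑ μ, ∑ ν, ext (volterra ν σ
      (coord μ w * frame hA (contDiff_curvature hA μ ν) σ)) t) = ext (curvatureForm hA σ w) := by
    ext1 t
    simp only [curvatureForm, ext_sum]
  rw [e] at h
  refine h.congr fun t _ => ?_
  simp only [ext_coord_mul, smul_smul, mul_comm]

theorem ext_curvatureForm_zero (σ w : Curve d k) : ext (curvatureForm hA σ w) 0 = 0 := by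
  simp [curvatureForm, ext_sum, ext_volterra_zero]

/-! ### Variation of the transport and of framed functions with respect to the curve. -/

theorem fderiv_path_mul {f g : Curve d k → Path N} {σ : Curve d k}
    (hf : DifferentiableAt ℝ f σ) (hg : DifferentiableAt ℝ g σ) (w : Curve d k) :
    fderiv ℝ (fun σ => f σ * g σ) σ w = f σ * fderiv ℝ g σ w + fderiv ℝ f σ w * g σ := by
  rw [fderiv_fun_mul' hf hg, add_apply]
  rfl

theorem differentiable_transport : Differentiable ℝ (transport hA : Curve d k → Path N) :=
  (contDiff_transport hA).differentiable (by simp)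

theorem differentiable_cotransport : Differentiable ℝ (cotransport hA : Curve d k → Path N) :=
  (contDiff_cotransport hA).differentiable (by simp)

theorem differentiable_pullback {Φ : Space d → Mat N} (hΦ : ContDiff ℝ ∞ Φ) :
    Differentiable ℝ (pullback Φ hΦ : Curve d k → Path N) :=
  (contDiff_pullback hΦ).differentiable (by simp)

theorem fderiv_volterra {f : Curve d k → Path N} {σ : Curve d k} (hf : DifferentiableAt ℝ f σ)
    (i : Fin d) (w : Curve d k) : fderiv ℝ (fun σ => volterra i σ (f σ)) σ w
      = volterra i w (f σ) + volterra i σ (fderiv ℝ f σ w) := by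
  have h := ((volterra (d := d) (N := N) (k := k) i).hasFDerivAt (x := σ)).clm_apply hf.hasFDerivAt
  rw [h.fderiv]
  simp [add_comm]

theorem differentiableAt_volterra {f : Curve d k → Path N} {σ : Curve d k}
    (hf : DifferentiableAt ℝ f σ) (i : Fin d) :
    DifferentiableAt ℝ (fun σ => volterra i σ (f σ)) σ :=
  ((volterra (d := d) (N := N) (k := k) i).hasFDerivAt (x := σ)).differentiableAt.clm_apply hf

theorem fderiv_pullback_apply {Φ : Space d → Mat N} (hΦ : ContDiff ℝ ∞ Φ) (σ w : Curve d k) :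
    fderiv ℝ (pullback Φ hΦ) σ w
      = ∑ i, coord i w * pullback (partialDeriv i Φ) (hΦ.partialDeriv i) σ := by
  rw [(hasFDerivAt_pullback hΦ σ).fderiv, pullbackDeriv_apply]

/-- The three contributions come from varying the velocity in the integral, the transport, and the
point at which `A` is evaluated. -/
theorem fderiv_transport_eq (σ w : Curve d k) : fderiv ℝ (transport hA) σ w
    = -∑ ν, (volterra ν w (pullback (A ν) (hA ν) σ * transport hA σ)
      + volterra ν σ (pullback (A ν) (hA ν) σ * fderiv ℝ (transport hA) σ w
        + (∑ i, coord i w * pullback (partialDeriv i (A ν)) ((hA ν).partialDeriv i) σ)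
          * transport hA σ)) := by
  have hd : ∀ ν, DifferentiableAt ℝ
      (fun σ : Curve d k => pullback (A ν) (hA ν) σ * transport hA σ) σ := fun ν =>
    (differentiable_pullback (hA ν) σ).mul (differentiable_transport hA σ)
  conv_lhs => rw [show (transport hA : Curve d k → Path N) = fun σ =>
    1 - ∑ i, volterra i σ (pullback (A i) (hA i) σ * transport hA σ) from
      funext (transport_eq hA)]
  rw [fderiv_const_sub, fderiv_fun_sum fun i _ => differentiableAt_volterra (hd i) i]
  simp only [neg_apply, sum_apply]
  congr 1
  refine Finset.sum_congr rfl fun ν _ => ?_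
  rw [fderiv_volterra (hd ν), fderiv_path_mul (differentiable_pullback (hA ν) σ)
    (differentiable_transport hA σ), fderiv_pullback_apply]

/-- Non-abelian Stokes formula. Multiplication by `Z` removes the homogeneous part of the equation
for `∂_w W`; integrating the remaining `w'` term by parts produces the gauge term `w^i Z A_i W` and
leaves the curvature. It is proved by checking that the sum of all terms has zero derivative and
vanishes at `0`. -/
theorem cotransport_mul_fderiv_transport (σ w : Curve d k) :
    cotransport hA σ * fderiv ℝ (transport hA) σ w
      = -(∑ i, coord i w * frame hA (hA i) σ) - curvatureForm hA σ w := by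
  set D := fderiv ℝ (transport hA) σ w with hD
  have hDprim : IsPrimitive (ext D) (fun t => -∑ ν, (velocity w t ν •
      (A ν (position σ t) * ext (transport hA σ) t) + velocity σ t ν •
      (A ν (position σ t) * ext D t + (∑ i, position w t i •
        partialDeriv i (A ν) (position σ t)) * ext (transport hA σ) t))) := by
    have h := (IsPrimitive.sum (s := Finset.univ) fun ν _ =>
      (isPrimitive_volterra ν w (pullback (A ν) (hA ν) σ * transport hA σ)).add
      (isPrimitive_volterra ν σ (pullback (A ν) (hA ν) σ * fderiv ℝ (transport hA) σ w
        + (∑ i, coord i w * pullback (partialDeriv i (A ν)) ((hA ν).partialDeriv i) σ)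
          * transport hA σ))).neg
    rw [← hD] at h
    simp only [← ext_add, ← ext_sum, ← ext_neg] at h
    have e := fderiv_transport_eq hA σ w
    rw [← hD] at e
    change IsPrimitive (ext _) _ at h
    rw [← e] at h
    refine h.congr fun t _ => ?_
    simp only [ext_add, ext_mul, ext_pullback, ext_sum, ext_coord, smul_mul_assoc, one_mul]
  have hD0 : ext D 0 = 0 := by
    rw [hD, fderiv_transport_eq]
    simp [ext_neg, ext_sum, ext_add, ext_volterra_zero]
  have h1 := (isPrimitive_cotransport hA σ).mul hDprim
  have h2 : IsPrimitive (fun t => ∑ i, ext (coord (N := N) i w * frame hA (hA i) σ) t)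
      (fun t => ∑ i, (velocity w t i • ext (frame hA (hA i) σ) t + position w t i •
        ∑ j, velocity σ t j • ext (frame hA (contDiff_covDeriv hA j (hA i)) σ) t)) := by
    refine IsPrimitive.sum fun i _ => ?_
    have hc : IsPrimitive (ext (coord (N := N) i w)) (fun t => velocity w t i • (1 : Mat N)) :=
      (isPrimitive_position_apply w i).clm_comp ((ContinuousLinearMap.id ℝ ℝ).smulRight (1 : Mat N))
    refine (hc.mul (isPrimitive_frame hA (hA i) σ)).congr fun t _ => ?_
    rw [ext_coord, smul_mul_assoc, one_mul, smul_mul_assoc, one_mul]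
  refine path_ext fun t ht => ?_
  have h3 := ((h1.add h2).add (isPrimitive_curvatureForm hA σ w)).eqOn
    (IsPrimitive.const 0) (Eventually.of_forall fun s => ?_)
    (by simp [hD0, ext_curvatureForm_zero, ext_coord_mul, position_zero]) ht
  · rw [ext_sub, ext_neg, ext_sum, ext_mul, ← sub_eq_zero, ← h3]
    abel
  · simp only [ext_frame, alongCurve, covDeriv, curvature]
    set Z := ext (cotransport hA σ) s
    set W := ext (transport hA σ) s
    set x := position σ s
    have hswap : ∑ i, ∑ j, (position w s i * velocity σ s j) • (Z * partialDeriv i (A j) x * W)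
        = ∑ j, ∑ i, (position w s i * velocity σ s j) • (Z * partialDeriv i (A j) x * W) :=
      Finset.sum_comm
    -- This is `F_{ij} = ∂_i A_j - ∇_j A_i`: the first term comes from varying `A`, the second from
    -- differentiating the framed `A_i` along `σ`.
    have e1 : ∀ i j, (position w s i * velocity σ s j) • (Z * (partialDeriv i (A j) x
        - partialDeriv j (A i) x + (A i x * A j x - A j x * A i x)) * W)
        = (position w s i * velocity σ s j) • (Z * partialDeriv i (A j) x * W)
          - position w s i • velocity σ s j • (Z * (partialDeriv j (A i) x
            + (A j x * A i x - A i x * A j x)) * W) := by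
      intro i j
      rw [smul_smul, ← smul_sub]
      congr 1
      noncomm_ring
    simp only [e1, Finset.sum_sub_distrib, hswap]
    simp only [Finset.sum_add_distrib, Finset.smul_sum,
      mul_neg, mul_add, Finset.mul_sum, Finset.sum_mul, smul_mul_assoc, mul_smul_comm, smul_add,
      smul_smul, mul_assoc]
    simp only [mul_comm (position w s _) (velocity σ s _)]
    abel

theorem fderiv_cotransport_mul (σ w : Curve d k) :
    fderiv ℝ (cotransport hA) σ w * transport hA σ
      = -(cotransport hA σ * fderiv ℝ (transport hA) σ w) := by
  have h := fderiv_path_mul (differentiable_cotransport hA σ) (differentiable_transport hA σ) w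
  have e : (fun σ : Curve d k => cotransport hA σ * transport hA σ) = fun _ => 1 :=
    funext (cotransport_mul_transport hA)
  rw [e] at h
  simp only [fderiv_fun_const, Pi.zero_apply, zero_apply] at h
  exact (neg_eq_of_add_eq_zero_right h.symm).symm

theorem frame_covDeriv {Φ : Space d → Mat N} (hΦ : ContDiff ℝ ∞ Φ) (l : Fin d) (σ : Curve d k) :
    frame hA (contDiff_covDeriv hA l hΦ) σ = frame hA (hΦ.partialDeriv l) σ
      + (frame hA (hA l) σ * frame hA hΦ σ - frame hA hΦ σ * frame hA (hA l) σ) := by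
  have e : pullback _ (contDiff_covDeriv hA l hΦ) σ = pullback _ (hΦ.partialDeriv l) σ
      + (pullback _ (hA l) σ * pullback _ hΦ σ - pullback _ hΦ σ * pullback _ (hA l) σ) := rfl
  have hWZ := transport_mul_cotransport hA σ
  have h : ∀ a b : Path N, (cotransport hA σ * a * transport hA σ)
      * (cotransport hA σ * b * transport hA σ)
      = cotransport hA σ * (a * b) * transport hA σ := by
    intro a b
    calc _ = cotransport hA σ * a * (transport hA σ * cotransport hA σ) * b * transport hA σ := by
          noncomm_ring
      _ = _ := by rw [hWZ]; noncomm_ring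
  simp only [frame, e, h, mul_add, add_mul, mul_sub, sub_mul]

theorem coord_commute (i : Fin d) (w : Curve d k) (f : Path N) : coord i w * f = f * coord i w := by
  refine path_ext fun t _ => ?_
  simp only [ext_mul, ext_coord, smul_mul_assoc, mul_smul_comm, one_mul, mul_one]

theorem differentiable_frame {Φ : Space d → Mat N} (hΦ : ContDiff ℝ ∞ Φ) :
    Differentiable ℝ (frame hA hΦ : Curve d k → Path N) :=
  ((differentiable_cotransport hA).mul (differentiable_pullback hΦ)).mul
    (differentiable_transport hA)

/-- The noncommutative algebra of differentiating `Z P W`: inserting `W * Z = 1` turns the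
variations of both outer factors into commutators with `Γ + M`. -/
theorem conjugate_derivative {R : Type*} [Ring R] {Z W P S D D' M Γ : R} (hWZ : W * Z = 1)
    (hD' : D' * W = -(Z * D)) (hD : Z * D = -Γ - M) :
    Z * P * D + (Z * S + D' * P) * W = Z * S * W + (Γ * (Z * P * W) - Z * P * W * Γ)
      + (M * (Z * P * W) - Z * P * W * M) := by
  have e1 : Z * P * D = Z * P * W * (Z * D) := by
    calc _ = Z * P * 1 * D := by rw [mul_one]
      _ = _ := by rw [← hWZ]; noncomm_ring
  have e2 : D' * P * W = -(Z * D) * (Z * P * W) := by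
    calc _ = D' * 1 * P * W := by rw [mul_one]
      _ = _ := by rw [← hWZ, ← hD']; noncomm_ring
  rw [add_mul, e1, e2, hD]
  noncomm_ring

/-- The gauge part of the first variation combines with `∂_i Φ` into `∇_i Φ`, so only the non-local
part survives, as a commutator. -/
theorem fderiv_frame_apply {Φ : Space d → Mat N} (hΦ : ContDiff ℝ ∞ Φ) (σ w : Curve d k) :
    fderiv ℝ (frame hA hΦ) σ w
      = ∑ i, coord i w * frame hA (contDiff_covDeriv hA i hΦ) σ
        + (curvatureForm hA σ w * frame hA hΦ σ - frame hA hΦ σ * curvatureForm hA σ w) := by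
  have h1 : fderiv ℝ (frame hA hΦ) σ w = _ :=
    fderiv_path_mul ((differentiable_cotransport hA σ).mul (differentiable_pullback hΦ σ))
      (differentiable_transport hA σ) w
  have h2 := fderiv_path_mul (differentiable_cotransport hA σ) (differentiable_pullback hΦ σ) w
  have h3 : ∑ i, coord i w * frame hA (contDiff_covDeriv hA i hΦ) σ
      = cotransport hA σ * (∑ i, coord i w * pullback (partialDeriv i Φ) (hΦ.partialDeriv i) σ)
          * transport hA σ
        + ((∑ i, coord i w * frame hA (hA i) σ) * frame hA hΦ σ
          - frame hA hΦ σ * ∑ i, coord i w * frame hA (hA i) σ) := by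
    simp only [Finset.sum_mul, Finset.mul_sum]
    rw [← Finset.sum_sub_distrib, ← Finset.sum_add_distrib]
    refine Finset.sum_congr rfl fun i _ => ?_
    rw [frame_covDeriv hA hΦ, ← mul_assoc (frame hA hΦ σ), ← coord_commute,
      ← mul_assoc (cotransport hA σ), ← coord_commute, mul_add, mul_sub]
    simp only [frame, mul_assoc]
  rw [h1]
  have h4 := conjugate_derivative (P := pullback Φ hΦ σ) (S := fderiv ℝ (pullback Φ hΦ) σ w)
    (transport_mul_cotransport hA σ) (fderiv_cotransport_mul hA σ w)
    (cotransport_mul_fderiv_transport hA σ w)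
  refine (congrArg (fun x => cotransport hA σ * pullback Φ hΦ σ * fderiv ℝ (transport hA) σ w
      + x * transport hA σ) h2).trans (h4.trans ?_)
  rw [h3, fderiv_pullback_apply]
  rfl

end Derivatives

/-! ### The form `B^A` and its derivative -/

section Form

variable {d N : ℕ} {k : CurveClass} {A : Fin d → Space d → Mat N}

/-- Evaluation of a path at `t = 1`. -/
noncomputable def endpoint (N : ℕ) : Path N →L[ℝ] Mat N :=
  ContinuousMap.evalCLM ℝ (Set.projIcc 0 1 zero_le_one 1)

variable (hA : ∀ μ, ContDiff ℝ ∞ (A μ))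
include hA

theorem parallelTransport_one_zero :
    (parallelTransport A 1 0 : Curve d k → Mat N) = fun σ => endpoint N (transport hA σ) :=
  funext fun σ => parallelTransport_zero_right hA σ (by simp)

theorem parallelTransport_zero_one :
    (parallelTransport A 0 1 : Curve d k → Mat N) = fun σ => endpoint N (cotransport hA σ) :=
  funext fun σ => parallelTransport_zero_left hA σ (by simp)

theorem contDiff_parallelTransport_one_zero :
    ContDiff ℝ ∞ (parallelTransport A 1 0 : Curve d k → Mat N) := by
  rw [parallelTransport_one_zero hA]
  exact (endpoint N).contDiff.comp (contDiff_transport hA)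

theorem contDiff_parallelTransport_zero_one :
    ContDiff ℝ ∞ (parallelTransport A 0 1 : Curve d k → Mat N) := by
  rw [parallelTransport_zero_one hA]
  exact (endpoint N).contDiff.comp (contDiff_cotransport hA)

theorem parallelTransport_zero_one_mul (σ : Curve d k) :
    parallelTransport A 0 1 σ * parallelTransport A 1 0 σ = 1 := by
  rw [parallelTransport_one_zero hA, parallelTransport_zero_one hA]
  exact ext_cotransport_mul_transport hA σ 1

theorem parallelTransport_one_zero_mul (σ : Curve d k) :
    parallelTransport A 1 0 σ * parallelTransport A 0 1 σ = 1 := by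
  rw [parallelTransport_one_zero hA, parallelTransport_zero_one hA]
  exact ext_transport_mul_cotransport hA σ 1

theorem contDiff_transportForm :
    ContDiff ℝ ∞ (transportForm A : Curve d k → (Loop d k →L[ℝ] Mat N)) := by
  refine ContDiff.clm_comp (ContDiff.clm_comp ?_ ?_) contDiff_const
  · exact (ContinuousLinearMap.contDiff _).comp (contDiff_parallelTransport_zero_one hA)
  · exact (contDiff_parallelTransport_one_zero hA).fderiv_right (by simp)

/-- The gauge term of the Stokes formula is proportional to `v(1)`, which is zero for a loop. -/
theorem transportForm_apply (σ : Curve d k) (v : Loop d k) :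
    transportForm A σ v = -ext (curvatureForm hA σ v.1) 1 := by
  have h1 : transportForm A σ v
      = parallelTransport A 0 1 σ * fderiv ℝ (parallelTransport A 1 0) σ v.1 := rfl
  have h2 : fderiv ℝ (parallelTransport A 1 0) σ v.1
      = ext (fderiv ℝ (transport hA) σ v.1) 1 := by
    rw [parallelTransport_one_zero hA]
    exact congrArg (fun T : Curve d k →L[ℝ] Mat N => T v.1)
      ((endpoint N).hasFDerivAt.comp σ (differentiable_transport hA σ).hasFDerivAt).fderiv
  rw [h1, h2, parallelTransport_zero_one hA]
  change ext (cotransport hA σ * fderiv ℝ (transport hA) σ v.1) 1 = _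
  rw [cotransport_mul_fderiv_transport, ext_sub, ext_neg, ext_sum]
  simp [ext_coord_mul, position_one]

theorem fderiv_parallelTransport_apply (σ : Curve d k) (v : Loop d k) :
    fderiv ℝ (parallelTransport A 1 0) σ v.1
      = parallelTransport A 1 0 σ * transportForm A σ v := by
  have h1 : transportForm A σ v
      = parallelTransport A 0 1 σ * fderiv ℝ (parallelTransport A 1 0) σ v.1 := rfl
  rw [h1, ← mul_assoc, parallelTransport_one_zero_mul hA, one_mul]

omit hA in
/-- The derivative of the curvature form `σ ↦ curvatureForm σ v` in the direction `w`. -/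
noncomputable def curvatureFormDeriv (hA : ∀ μ, ContDiff ℝ ∞ (A μ)) (σ w v : Curve d k) :
    Path N :=
  ∑ μ, ∑ ν, (volterra ν w (coord μ v * frame hA (contDiff_curvature hA μ ν) σ)
    + volterra ν σ (coord μ v * (∑ i, coord i w *
        frame hA (contDiff_covDeriv hA i (contDiff_curvature hA μ ν)) σ
      + (curvatureForm hA σ w * frame hA (contDiff_curvature hA μ ν) σ
        - frame hA (contDiff_curvature hA μ ν) σ * curvatureForm hA σ w))))

omit hA in
theorem differentiableAt_and_fderiv_curvatureForm (hA : ∀ μ, ContDiff ℝ ∞ (A μ)) (σ v : Curve d k) :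
    DifferentiableAt ℝ (fun σ => curvatureForm hA σ v) σ ∧ ∀ w,
      fderiv ℝ (fun σ => curvatureForm hA σ v) σ w = curvatureFormDeriv hA σ w v := by
  have hd : ∀ μ ν, DifferentiableAt ℝ
      (fun σ : Curve d k => coord μ v * frame hA (contDiff_curvature hA μ ν) σ) σ := fun μ ν =>
    (differentiableAt_const _).mul (differentiable_frame hA _ σ)
  have h2 : ∀ μ ν, DifferentiableAt ℝ (fun σ : Curve d k =>
      volterra ν σ (coord μ v * frame hA (contDiff_curvature hA μ ν) σ)) σ := fun μ ν =>
    differentiableAt_volterra (hd μ ν) ν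
  have h3 : ∀ μ, DifferentiableAt ℝ (fun σ : Curve d k =>
      ∑ ν, volterra ν σ (coord μ v * frame hA (contDiff_curvature hA μ ν) σ)) σ := fun μ =>
    DifferentiableAt.fun_sum fun ν _ => h2 μ ν
  refine ⟨DifferentiableAt.fun_sum fun μ _ => h3 μ, fun w => ?_⟩
  simp only [curvatureForm]
  rw [fderiv_fun_sum fun μ _ => h3 μ, sum_apply]
  refine Finset.sum_congr rfl fun μ _ => ?_
  rw [fderiv_fun_sum fun ν _ => h2 μ ν, sum_apply]
  refine Finset.sum_congr rfl fun ν _ => ?_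
  rw [fderiv_volterra (hd μ ν), fderiv_path_mul (differentiableAt_const _)
    (differentiable_frame hA _ σ), fderiv_frame_apply]
  simp only [fderiv_fun_const, Pi.zero_apply, zero_apply, zero_mul, add_zero]

theorem fderiv_transportForm_apply (σ w : Curve d k) (v : Loop d k) :
    fderiv ℝ (fun τ => transportForm A τ v) σ w = -ext (curvatureFormDeriv hA σ w v.1) 1 := by
  have h := differentiableAt_and_fderiv_curvatureForm hA σ v.1
  have e : (fun τ : Curve d k => transportForm A τ v)
      = fun τ => -endpoint N (curvatureForm hA τ v.1) :=
    funext fun τ => transportForm_apply hA τ v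
  have h1 : HasFDerivAt (fun τ => -endpoint N (curvatureForm hA τ v.1)) _ σ :=
    ((endpoint N).hasFDerivAt.comp σ h.1.hasFDerivAt).neg
  rw [e, h1.fderiv]
  change -endpoint N (fderiv ℝ (fun σ => curvatureForm hA σ v.1) σ w) = _
  rw [h.2]
  rfl

theorem firstDerivative_transportForm (σ : Curve d k) (w v : Loop d k) :
    firstDerivative (transportForm A) σ w v = -ext (curvatureFormDeriv hA σ w.1 v.1) 1 := by
  rw [← fderiv_transportForm_apply hA]
  have hd : DifferentiableAt ℝ (transportForm A : Curve d k → (Loop d k →L[ℝ] Mat N)) σ :=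
    (contDiff_transportForm hA).differentiable (by simp) σ
  have h := hd.hasFDerivAt.clm_apply (hasFDerivAt_const v σ)
  rw [h.fderiv]
  simp [firstDerivative]

/-- Product rule for `∂_v U = U B v`. Since `B v = -M_v(1)`, the product `(B w)(B v)` enters with a
plus sign. -/
theorem secondDerivative_parallelTransport (σ : Curve d k) (w v : Loop d k) :
    secondDerivative (parallelTransport A 1 0) σ w v = parallelTransport A 1 0 σ *
      (ext (curvatureForm hA σ w.1) 1 * ext (curvatureForm hA σ v.1) 1
        - ext (curvatureFormDeriv hA σ w.1 v.1) 1) := by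
  have hU := contDiff_parallelTransport_one_zero (k := k) hA
  have hd : DifferentiableAt ℝ (fderiv ℝ (parallelTransport A 1 0 : Curve d k → Mat N)) σ :=
    (hU.fderiv_right (m := ∞) (by simp)).differentiable (by simp) σ
  have h1 : secondDerivative (parallelTransport A 1 0) σ w v
      = fderiv ℝ (fun τ => fderiv ℝ (parallelTransport A 1 0) τ v.1) σ w.1 := by
    rw [(hd.hasFDerivAt.clm_apply (hasFDerivAt_const v.1 σ)).fderiv]
    simp [secondDerivative]
  have hB : DifferentiableAt ℝ (fun τ : Curve d k => transportForm A τ v) σ :=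
    ((contDiff_transportForm hA).differentiable (by simp) σ).clm_apply (differentiableAt_const v)
  have hUd : DifferentiableAt ℝ (parallelTransport A 1 0 : Curve d k → Mat N) σ :=
    hU.differentiable (by simp) σ
  have h2 : (fun τ : Curve d k => fderiv ℝ (parallelTransport A 1 0) τ v.1)
      = fun τ => parallelTransport A 1 0 τ * transportForm A τ v :=
    funext fun τ => fderiv_parallelTransport_apply hA τ v
  rw [h1, h2, fderiv_fun_mul' hUd hB, add_apply]
  change parallelTransport A 1 0 σ * fderiv ℝ (fun τ => transportForm A τ v) σ w.1
    + fderiv ℝ (parallelTransport A 1 0) σ w.1 * transportForm A σ v = _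
  rw [fderiv_parallelTransport_apply hA, fderiv_transportForm_apply hA, transportForm_apply hA,
    transportForm_apply hA]
  noncomm_ring

end Form

/-! ### The Bianchi identity -/

section Bianchi

variable {d N : ℕ} {A : Fin d → Space d → Mat N}

theorem partialDeriv_add {Φ Ψ : Space d → Mat N} (hΦ : ContDiff ℝ ∞ Φ) (hΨ : ContDiff ℝ ∞ Ψ)
    (l : Fin d) (x : Space d) : partialDeriv l (fun y => Φ y + Ψ y) x
      = partialDeriv l Φ x + partialDeriv l Ψ x := by
  simp only [partialDeriv]
  rw [fderiv_fun_add (hΦ.differentiable (by simp) x) (hΨ.differentiable (by simp) x), add_apply]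

theorem partialDeriv_sub {Φ Ψ : Space d → Mat N} (hΦ : ContDiff ℝ ∞ Φ) (hΨ : ContDiff ℝ ∞ Ψ)
    (l : Fin d) (x : Space d) : partialDeriv l (fun y => Φ y - Ψ y) x
      = partialDeriv l Φ x - partialDeriv l Ψ x := by
  simp only [partialDeriv]
  rw [fderiv_fun_sub (hΦ.differentiable (by simp) x) (hΨ.differentiable (by simp) x), sub_apply]

theorem partialDeriv_mul {Φ Ψ : Space d → Mat N} (hΦ : ContDiff ℝ ∞ Φ) (hΨ : ContDiff ℝ ∞ Ψ)
    (l : Fin d) (x : Space d) : partialDeriv l (fun y => Φ y * Ψ y) x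
      = Φ x * partialDeriv l Ψ x + partialDeriv l Φ x * Ψ x := by
  simp only [partialDeriv]
  rw [fderiv_fun_mul' (hΦ.differentiable (by simp) x) (hΨ.differentiable (by simp) x), add_apply]
  rfl

theorem partialDeriv_comm {Φ : Space d → Mat N} (hΦ : ContDiff ℝ ∞ Φ) (l m : Fin d)
    (x : Space d) : partialDeriv l (partialDeriv m Φ) x = partialDeriv m (partialDeriv l Φ) x := by
  have hd : DifferentiableAt ℝ (fderiv ℝ Φ) x :=
    (hΦ.fderiv_right (m := ∞) (by simp)).differentiable (by simp) x
  have h : ∀ l m : Fin d, partialDeriv l (partialDeriv m Φ) x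
      = fderiv ℝ (fderiv ℝ Φ) x (EuclideanSpace.single l 1) (EuclideanSpace.single m 1) := by
    intro l m
    have h1 := hd.hasFDerivAt.clm_apply
      (hasFDerivAt_const (EuclideanSpace.single m (1 : ℝ) : Space d) x)
    change fderiv ℝ (fun y => fderiv ℝ Φ y (EuclideanSpace.single m 1)) x _ = _
    rw [h1.fderiv]
    simp
  rw [h, h]
  exact ((contDiff_infty.1 hΦ 2).contDiffAt.isSymmSndFDerivAt (by simp)) _ _

theorem curvature_swap (μ ν : Fin d) (x : Space d) : curvature A ν μ x = -curvature A μ ν x := by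
  simp only [curvature]; abel

theorem covDeriv_curvature_swap (l μ ν : Fin d) (x : Space d) :
    covDeriv A l (curvature A ν μ) x = -covDeriv A l (curvature A μ ν) x := by
  have e : curvature A ν μ = fun x => -curvature A μ ν x := funext (curvature_swap μ ν)
  rw [e]
  simp only [covDeriv, partialDeriv]
  rw [fderiv_fun_neg, neg_apply]
  noncomm_ring

/-- The second derivatives of `A` cancel in pairs by symmetry; what remains is the Leibniz rule and
the Jacobi identity. -/
theorem bianchi (hA : ∀ μ, ContDiff ℝ ∞ (A μ)) (l μ ν : Fin d) (x : Space d) :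
    covDeriv A l (curvature A μ ν) x + covDeriv A μ (curvature A ν l) x
      + covDeriv A ν (curvature A l μ) x = 0 := by
  have h : ∀ l μ ν : Fin d, partialDeriv l (curvature A μ ν) x
      = partialDeriv l (partialDeriv μ (A ν)) x - partialDeriv l (partialDeriv ν (A μ)) x
        + (A μ x * partialDeriv l (A ν) x + partialDeriv l (A μ) x * A ν x
          - (A ν x * partialDeriv l (A μ) x + partialDeriv l (A ν) x * A μ x)) := by
    intro l μ ν
    have h1 := ((hA ν).partialDeriv μ).sub ((hA μ).partialDeriv ν)
    have h2 := (hA μ).mul (hA ν)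
    have h3 := (hA ν).mul (hA μ)
    have e : curvature A μ ν = fun y => (partialDeriv μ (A ν) y - partialDeriv ν (A μ) y)
      + (A μ y * A ν y - A ν y * A μ y) := rfl
    rw [e, partialDeriv_add h1 (h2.sub h3), partialDeriv_sub ((hA ν).partialDeriv μ)
      ((hA μ).partialDeriv ν), partialDeriv_sub h2 h3, partialDeriv_mul (hA μ) (hA ν),
      partialDeriv_mul (hA ν) (hA μ)]
  simp only [covDeriv, h]
  rw [partialDeriv_comm (hA ν) l μ, partialDeriv_comm (hA μ) l ν, partialDeriv_comm (hA l) μ ν]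
  simp only [curvature]
  noncomm_ring

end Bianchi

/-! ### The kernels of the derivative of `B^A` -/

section Kernels

/-- Pointwise form of the integration by parts, read with `X = F`, `Y i μ ν = ∇_i F_{μν}` and `s =
σ'`. Subtracting half of the derivative of `X_{μν} w^μ v^ν` splits the term in `w'` evenly between
`w'` and `v'`; antisymmetry of `X` then gives the required singular form. -/
theorem levy_kernel_identity {E : Type*} [AddCommGroup E] [Module ℝ E] {d : ℕ}
    (w w' v v' s : Fin d → ℝ) (X : Fin d → Fin d → E) (hX : ∀ μ ν, X ν μ = -X μ ν)
    (Y : Fin d → Fin d → Fin d → E) :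
    -(∑ μ, ∑ ν, (w' ν * v μ) • X μ ν + ∑ μ, ∑ ν, (s ν * v μ) • ∑ i, w i • Y i μ ν)
      - (1 / 2 : ℝ) • ∑ μ, ∑ ν, ((w' μ * v ν + w μ * v' ν) • X μ ν
        + (w μ * v ν) • ∑ i, s i • Y i μ ν)
    = ∑ μ, ∑ ν, (w μ * v ν) • -(∑ κ, s κ • (Y μ ν κ + (1 / 2 : ℝ) • Y κ μ ν))
      + (1 / 2 : ℝ) • ∑ μ, ∑ ν, (w' μ * v ν + v' μ * w ν) • X μ ν := by
  have h1 : ∑ μ, ∑ ν, (w' ν * v μ) • X μ ν = -∑ μ, ∑ ν, (w' μ * v ν) • X μ ν := by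
    rw [Finset.sum_comm]
    simp only [← Finset.sum_neg_distrib, ← smul_neg, ← hX]
  have h2 : ∑ μ, ∑ ν, (v' μ * w ν) • X μ ν = -∑ μ, ∑ ν, (w μ * v' ν) • X μ ν := by
    rw [Finset.sum_comm]
    simp only [← Finset.sum_neg_distrib, ← smul_neg, ← hX, mul_comm]
  have h3 : ∑ μ, ∑ ν, (s ν * v μ) • ∑ i, w i • Y i μ ν
      = ∑ μ, ∑ ν, (w μ * v ν) • ∑ κ, s κ • Y μ ν κ := by
    simp only [Finset.smul_sum, smul_smul]
    have e : ∀ f : Fin d → Fin d → Fin d → E,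
        ∑ μ, ∑ ν, ∑ i, f μ ν i = ∑ i, ∑ μ, ∑ ν, f μ ν i := by
      intro f
      rw [Finset.sum_congr rfl fun μ _ => Finset.sum_comm, Finset.sum_comm]
    rw [e]
    refine Finset.sum_congr rfl fun i _ => Finset.sum_congr rfl fun μ _ =>
      Finset.sum_congr rfl fun ν _ => ?_
    congr 1
    ring
  rw [h1, h3]
  simp only [add_smul, smul_add, smul_neg, Finset.sum_add_distrib, Finset.sum_neg_distrib, h2]
  have h4 : ∑ μ, ∑ ν, (w μ * v ν) • ∑ κ, s κ • (1 / 2 : ℝ) • Y κ μ ν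
      = (1 / 2 : ℝ) • ∑ μ, ∑ ν, (w μ * v ν) • ∑ κ, s κ • Y κ μ ν := by
    simp only [Finset.smul_sum, smul_comm (1 / 2 : ℝ)]
  rw [h4]
  module

variable {d N : ℕ} {k : CurveClass} {A : Fin d → Space d → Mat N}
  (hA : ∀ μ, ContDiff ℝ ∞ (A μ))

/-- `t ↦ U_{0,t} F_{μν}(σ(t)) σ'^ν(t) U_{t,0}`. -/
noncomputable def curvatureCurrent (σ : Curve d k) (μ : Fin d) (t : ℝ) : Mat N :=
  ∑ ν, velocity σ t ν • ext (frame hA (contDiff_curvature hA μ ν) σ) t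

theorem integrable_curvatureCurrent (σ : Curve d k) (μ : Fin d) :
    Integrable (curvatureCurrent hA σ μ) unitMeasure :=
  integrable_finsetSum _ fun ν _ => integrable_velocity_smul σ ν (continuous_ext _)

theorem isPrimitive_curvatureForm_current (σ w : Curve d k) :
    IsPrimitive (ext (curvatureForm hA σ w))
      (fun t => ∑ μ, position w t μ • curvatureCurrent hA σ μ t) := by
  refine (isPrimitive_curvatureForm hA σ w).congr fun t _ => ?_
  simp only [curvatureCurrent, Finset.smul_sum, smul_smul]

/-- The Volterra kernel. -/
noncomputable def volterraKernel (P : Mat N) (c : ℝ) (σ : Curve d k) (μ ν : Fin d) (t s : ℝ) :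
    Mat N :=
  P * (c • (curvatureCurrent hA σ μ t * curvatureCurrent hA σ ν s))
    - if t < s then P * (curvatureCurrent hA σ μ t * curvatureCurrent hA σ ν s
      - curvatureCurrent hA σ ν s * curvatureCurrent hA σ μ t) else 0

/-- The Lévy kernel. -/
noncomputable def levyKernel (P : Mat N) (σ : Curve d k) (μ ν : Fin d) (t : ℝ) : Mat N :=
  P * -(∑ κ, velocity σ t κ •
    (ext (frame hA (contDiff_covDeriv hA μ (contDiff_curvature hA ν κ)) σ) t
      + (1 / 2 : ℝ) • ext (frame hA (contDiff_covDeriv hA κ (contDiff_curvature hA μ ν)) σ) t))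

/-- The singular kernel. -/
noncomputable def singularKernel (P : Mat N) (σ : Curve d k) (μ ν : Fin d) (t : ℝ) : Mat N :=
  P * ext (frame hA (contDiff_curvature hA μ ν) σ) t

theorem integrable_volterraKernel (P : Mat N) (c : ℝ) (σ : Curve d k) (μ ν : Fin d) :
    Integrable (fun p : ℝ × ℝ => volterraKernel hA P c σ μ ν p.1 p.2)
      (unitMeasure.prod unitMeasure) := by
  have h1 : Integrable (fun p : ℝ × ℝ => curvatureCurrent hA σ μ p.1 * curvatureCurrent hA σ ν p.2)
      (unitMeasure.prod unitMeasure) :=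
    (integrable_curvatureCurrent hA σ μ).mul_prod (integrable_curvatureCurrent hA σ ν)
  have h2 : Integrable (fun p : ℝ × ℝ => curvatureCurrent hA σ ν p.2 * curvatureCurrent hA σ μ p.1)
      (unitMeasure.prod unitMeasure) :=
    ((integrable_curvatureCurrent hA σ ν).mul_prod (integrable_curvatureCurrent hA σ μ)).swap
  have hm : MeasurableSet {p : ℝ × ℝ | p.1 < p.2} := measurableSet_lt measurable_fst measurable_snd
  refine ((h1.smul c).const_mul P).sub ((((h1.sub h2).const_mul P).indicator hm).congr
    (Eventually.of_forall fun p => ?_))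
  simp [indicator_apply]

theorem integrable_levyKernel (P : Mat N) (σ : Curve d k) (μ ν : Fin d) :
    Integrable (levyKernel hA P σ μ ν) unitMeasure := by
  have h : ∀ κ, Integrable (fun t => velocity σ t κ •
      (ext (frame hA (contDiff_covDeriv hA μ (contDiff_curvature hA ν κ)) σ) t + (1 / 2 : ℝ) •
        ext (frame hA (contDiff_covDeriv hA κ (contDiff_curvature hA μ ν)) σ) t)) unitMeasure :=
    fun κ => integrable_velocity_smul σ κ
      ((continuous_ext _).add ((continuous_ext _).const_smul (1 / 2 : ℝ)))
  exact (integrable_finsetSum Finset.univ fun κ _ => h κ).neg.const_mul P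

theorem continuous_singularKernel (P : Mat N) (σ : Curve d k) (μ ν : Fin d) :
    Continuous (singularKernel hA P σ μ ν) := continuous_const.mul (continuous_ext _)

theorem frame_curvature_swap (σ : Curve d k) (μ ν : Fin d) (t : ℝ) :
    ext (frame hA (contDiff_curvature hA ν μ) σ) t
      = -ext (frame hA (contDiff_curvature hA μ ν) σ) t := by
  rw [ext_frame, ext_frame, curvature_swap]
  noncomm_ring

theorem frame_covDeriv_curvature_swap (σ : Curve d k) (l μ ν : Fin d) (t : ℝ) :
    ext (frame hA (contDiff_covDeriv hA l (contDiff_curvature hA ν μ)) σ) t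
      = -ext (frame hA (contDiff_covDeriv hA l (contDiff_curvature hA μ ν)) σ) t := by
  rw [ext_frame, ext_frame, covDeriv_curvature_swap]
  noncomm_ring

theorem frame_bianchi (σ : Curve d k) (l μ ν : Fin d) (t : ℝ) :
    ext (frame hA (contDiff_covDeriv hA l (contDiff_curvature hA μ ν)) σ) t
      + ext (frame hA (contDiff_covDeriv hA μ (contDiff_curvature hA ν l)) σ) t
      + ext (frame hA (contDiff_covDeriv hA ν (contDiff_curvature hA l μ)) σ) t = 0 := by
  simp only [ext_frame]
  rw [← add_mul, ← add_mul, ← mul_add, ← mul_add, bianchi hA, mul_zero, zero_mul]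

/-- By Bianchi, `∇_μ F_{νκ} - ∇_ν F_{μκ} = -∇_κ F_{μν}`, which is exactly compensated by the
antisymmetric term `½ ∇_κ F_{μν}`. -/
theorem levyKernel_symm (P : Mat N) (σ : Curve d k) (μ ν : Fin d) (t : ℝ) :
    levyKernel hA P σ μ ν t = levyKernel hA P σ ν μ t := by
  simp only [levyKernel]
  refine congrArg (fun x => P * -x) (Finset.sum_congr rfl fun κ _ =>
    congrArg (fun x => velocity σ t κ • x) ?_)
  have h := frame_bianchi hA σ μ ν κ t
  rw [frame_covDeriv_curvature_swap hA σ ν μ κ] at h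
  rw [frame_covDeriv_curvature_swap hA σ κ μ ν]
  set a := ext (frame hA (contDiff_covDeriv hA μ (contDiff_curvature hA ν κ)) σ) t
  set b := ext (frame hA (contDiff_covDeriv hA ν (contDiff_curvature hA μ κ)) σ) t
  set e := ext (frame hA (contDiff_covDeriv hA κ (contDiff_curvature hA μ ν)) σ) t
  have hb : b = a + e := by rw [← sub_eq_zero, ← neg_eq_zero, ← h]; abel
  rw [hb]
  module

theorem isPrimitive_curvatureFormDeriv (σ w v : Curve d k) :
    IsPrimitive (ext (curvatureFormDeriv hA σ w v)) (fun t =>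
      (∑ μ, ∑ ν, (velocity w t ν * position v t μ) •
          ext (frame hA (contDiff_curvature hA μ ν) σ) t
        + ∑ μ, ∑ ν, (velocity σ t ν * position v t μ) • ∑ i, position w t i •
          ext (frame hA (contDiff_covDeriv hA i (contDiff_curvature hA μ ν)) σ) t)
      + (ext (curvatureForm hA σ w) t * (∑ μ, position v t μ • curvatureCurrent hA σ μ t)
        - (∑ μ, position v t μ • curvatureCurrent hA σ μ t) * ext (curvatureForm hA σ w) t)) := by
  have h := IsPrimitive.sum (s := Finset.univ) fun μ _ => IsPrimitive.sum (s := Finset.univ)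
    fun ν _ => (isPrimitive_volterra ν w (coord μ v * frame hA (contDiff_curvature hA μ ν) σ)).add
      (isPrimitive_volterra ν σ (coord μ v * (∑ i, coord i w *
        frame hA (contDiff_covDeriv hA i (contDiff_curvature hA μ ν)) σ
      + (curvatureForm hA σ w * frame hA (contDiff_curvature hA μ ν) σ
        - frame hA (contDiff_curvature hA μ ν) σ * curvatureForm hA σ w))))
  simp only [← ext_add, ← ext_sum] at h
  refine IsPrimitive.congr h fun t _ => ?_
  simp only [ext_coord_mul]
  simp only [ext_add, ext_sub, ext_sum, ext_coord_mul, curvatureCurrent, Finset.smul_sum,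
    smul_smul, smul_add, smul_sub, Finset.sum_add_distrib, Finset.mul_sum, Finset.sum_mul,
    Finset.sum_sub_distrib, mul_smul_comm, smul_mul_assoc]
  simp only [ext_mul, ← mul_assoc, mul_comm (velocity σ t _) (position v t _), add_assoc]

theorem integral_ite_lt {F : Type*} [NormedAddCommGroup F] [NormedSpace ℝ F] {p : ℝ → F}
    (hp : Integrable p unitMeasure) {t : ℝ} (ht : t ∈ Icc (0 : ℝ) 1) :
    IntervalIntegrable (fun s => if t < s then p s else 0) volume 0 1 ∧
    ∫ s in (0 : ℝ)..1, (if t < s then p s else 0) = ∫ s in t..1, p s := by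
  have hi : Integrable (fun s => if t < s then p s else 0) unitMeasure := by
    refine (hp.indicator (measurableSet_Ioi (a := t))).congr (Eventually.of_forall fun s => ?_)
    simp [indicator_apply]
  refine ⟨integrable_unit_iff.1 hi, ?_⟩
  rw [← intervalIntegral.integral_add_adjacent_intervals
    (intervalIntegrable_of_unit hi (by simp) ht) (intervalIntegrable_of_unit hi ht (by simp))]
  have h1 : ∫ s in (0 : ℝ)..t, (if t < s then p s else 0) = 0 := by
    rw [intervalIntegral.integral_congr (g := fun _ => (0 : F)) fun s hs => ?_]
    · simp
    · rw [uIcc_of_le ht.1] at hs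
      exact if_neg (not_lt.2 hs.2)
  rw [h1, zero_add]
  refine intervalIntegral.integral_congr_ae (Eventually.of_forall fun s hs => ?_)
  rw [uIoc_of_le ht.2] at hs
  exact if_pos hs.1

/-- The cut-off `t < s` encodes `M_w(s) = ∫_0^s`: exchanging the order of integration turns `∫
[M_w(s), M_v'(s)] ds` into the commutator of `M_w'(t)` with `M_v(1) - M_v(t)`. -/
theorem integral_volterraKernel (P : Mat N) (c : ℝ) (σ w v : Curve d k) {t : ℝ}
    (ht : t ∈ Icc (0 : ℝ) 1) :
    ∫ s in (0 : ℝ)..1, ∑ μ, ∑ ν, (position w t μ * position v s ν) • volterraKernel hA P c σ μ ν t s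
    = P * (c • ((∑ μ, position w t μ • curvatureCurrent hA σ μ t) * ext (curvatureForm hA σ v) 1)
      - ((∑ μ, position w t μ • curvatureCurrent hA σ μ t)
          * (ext (curvatureForm hA σ v) 1 - ext (curvatureForm hA σ v) t)
        - (ext (curvatureForm hA σ v) 1 - ext (curvatureForm hA σ v) t)
          * ∑ μ, position w t μ • curvatureCurrent hA σ μ t)) := by
  have hM := isPrimitive_curvatureForm_current hA σ v
  set p : ℝ → Mat N := fun s => ∑ μ, position v s μ • curvatureCurrent hA σ μ s with hp
  set q : Mat N := ∑ μ, position w t μ • curvatureCurrent hA σ μ t with hq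
  have e : ∀ s, ∑ μ, ∑ ν, (position w t μ * position v s ν) • volterraKernel hA P c σ μ ν t s
      = P * (c • (q * p s)) - if t < s then P * (q * p s - p s * q) else 0 := by
    intro s
    have e1 : q * p s = ∑ μ, ∑ ν, (position w t μ * position v s ν) •
        (curvatureCurrent hA σ μ t * curvatureCurrent hA σ ν s) := by
      simp only [hp, hq, Finset.sum_mul, Finset.mul_sum, smul_mul_assoc, mul_smul_comm, Finset.smul_sum,
        smul_smul]
      rw [Finset.sum_comm]
      simp only [mul_comm (position v s _)]
    have e2 : p s * q = ∑ μ, ∑ ν, (position w t μ * position v s ν) •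
        (curvatureCurrent hA σ ν s * curvatureCurrent hA σ μ t) := by
      simp only [hp, hq, Finset.sum_mul, Finset.mul_sum, smul_mul_assoc, mul_smul_comm, Finset.smul_sum,
        smul_smul]
    simp only [volterraKernel]
    split_ifs
    · rw [e1, e2]
      simp only [smul_sub, mul_sub, Finset.sum_sub_distrib, Finset.mul_sum, Finset.smul_sum,
        mul_smul_comm, smul_comm c]
    · rw [e1]
      simp only [sub_zero, Finset.mul_sum, Finset.smul_sum, mul_smul_comm, smul_comm c]
  simp only [e]
  have hpi : Integrable p unitMeasure := hM.integrable
  have hi1 : Integrable (fun s => P * (c • (q * p s))) unitMeasure :=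
    ((hpi.const_mul q).smul c).const_mul P
  have hi2 : Integrable (fun s => P * (q * p s - p s * q)) unitMeasure :=
    ((hpi.const_mul q).sub (hpi.mul_const q)).const_mul P
  rw [intervalIntegral.integral_sub (integrable_unit_iff.1 hi1) (integral_ite_lt hi2 ht).1,
    (integral_ite_lt hi2 ht).2]
  have hP1 := (IsPrimitive.const P).mul ((IsPrimitive.const (c • q)).mul hM)
  have h1 := (hP1.congr (q := fun s => P * (c • (q * p s))) fun s _ => by
    simp [hp]).integral_eq (s := 0) (t := 1) (by simp) (by simp)
  have hP2 := (IsPrimitive.const P).mul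
    (((IsPrimitive.const q).mul hM).sub (hM.mul (IsPrimitive.const q)))
  have h2 := (hP2.congr (q := fun s => P * (q * p s - p s * q)) fun s _ => by
    simp [hp]).integral_eq (s := t) (t := 1) ht (by simp)
  rw [h1, h2, ext_curvatureForm_zero]
  simp only [mul_zero, sub_zero, mul_sub, sub_mul, smul_mul_assoc]
  abel

/-- The parameters `P` and `c` cover both operators at once: `P` is a constant left factor, and `c`
weighs the product `M_w(1) M_v(1)`, which affects the Volterra kernel alone. -/
theorem isLevyRepresentation_kernels (P : Mat N) (c : ℝ) (σ : Curve d k)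
    {Q : Loop d k →L[ℝ] Loop d k →L[ℝ] Mat N}
    (hQ : ∀ w v : Loop d k, Q w v = P * (c • (ext (curvatureForm hA σ w.1) 1 *
      ext (curvatureForm hA σ v.1) 1) - ext (curvatureFormDeriv hA σ w.1 v.1) 1)) :
    IsLevyRepresentation Q (volterraKernel hA P c σ) (levyKernel hA P σ)
      (singularKernel hA P σ) where
  volterra_integrable := integrable_volterraKernel hA P c σ
  levy_integrable := integrable_levyKernel hA P σ
  singular_bounded μ ν := by
    refine memLp_top_of_bound (continuous_singularKernel hA P σ μ ν).aestronglyMeasurable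
      (‖P‖ * ‖frame hA (contDiff_curvature hA μ ν) σ‖) (Eventually.of_forall fun t => ?_)
    exact (norm_mul_le _ _).trans (mul_le_mul_of_nonneg_left (norm_ext_le _ _) (norm_nonneg _))
  levy_symm μ ν := Eventually.of_forall (levyKernel_symm hA P σ μ ν)
  singular_antisymm μ ν := Eventually.of_forall fun t => by
    simp only [singularKernel]
    rw [frame_curvature_swap, mul_neg]
  apply_eq w v := by
    set w₀ : Curve d k := w.1
    set v₀ : Curve d k := v.1
    set p : ℝ → Mat N := fun s => ∑ μ, position w₀ s μ • curvatureCurrent hA σ μ s with hp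
    set q : ℝ → Mat N := fun s => ∑ μ, position v₀ s μ • curvatureCurrent hA σ μ s with hq
    set m := ext (curvatureForm hA σ w₀) with hm
    set n := ext (curvatureForm hA σ v₀) with hn
    have hMw : IsPrimitive m p := isPrimitive_curvatureForm_current hA σ w₀
    have hMv : IsPrimitive n q := isPrimitive_curvatureForm_current hA σ v₀
    have hG := isPrimitive_curvatureFormDeriv hA σ w₀ v₀
    have hB : IsPrimitive (fun t => ∑ μ, ∑ ν, (position w₀ t μ * position v₀ t ν) •
          ext (frame hA (contDiff_curvature hA μ ν) σ) t)
        (fun t => ∑ μ, ∑ ν, ((velocity w₀ t μ * position v₀ t ν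
            + position w₀ t μ * velocity v₀ t ν) • ext (frame hA (contDiff_curvature hA μ ν) σ) t
          + (position w₀ t μ * position v₀ t ν) • ∑ i, velocity σ t i •
            ext (frame hA (contDiff_covDeriv hA i (contDiff_curvature hA μ ν)) σ) t)) := by
      refine IsPrimitive.sum fun μ _ => IsPrimitive.sum fun ν _ => ?_
      have h := (((isPrimitive_position_apply w₀ μ).mul (isPrimitive_position_apply v₀ ν)).clm_comp
        ((ContinuousLinearMap.id ℝ ℝ).smulRight (1 : Mat N))).mul
        (isPrimitive_frame hA (contDiff_curvature hA μ ν) σ)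
      simpa only [ContinuousLinearMap.smulRight_apply, ContinuousLinearMap.id_apply, smul_mul_assoc,
        one_mul] using h
    set V : ℝ → Mat N := fun t => P * (c • (p t * n 1) - (p t * (n 1 - n t) - (n 1 - n t) * p t))
    set L : ℝ → Mat N := fun t => ∑ μ, ∑ ν, (position w₀ t μ * position v₀ t ν) •
      levyKernel hA P σ μ ν t with hL
    set S : ℝ → Mat N := fun t => ∑ μ, ∑ ν, (velocity w₀ t μ * position v₀ t ν
      + velocity v₀ t μ * position w₀ t ν) • singularKernel hA P σ μ ν t with hS
    have hV : ∫ t in (0 : ℝ)..1, ∫ s in (0 : ℝ)..1, ∑ μ, ∑ ν,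
        (position w₀ t μ * position v₀ s ν) • volterraKernel hA P c σ μ ν t s
        = ∫ t in (0 : ℝ)..1, V t := by
      refine intervalIntegral.integral_congr fun t ht => ?_
      rw [uIcc_of_le zero_le_one] at ht
      exact integral_volterraKernel hA P c σ w₀ v₀ ht
    -- An explicit primitive of the total integrand. The commutator `[m, n]` carries out the
    -- exchange of integrals as an integration by parts, and at `t = 1` it cancels `[m, n 1]`. The
    -- half of `hB` is the total derivative removed from the `w'` term; it vanishes at both ends
    -- since `w(0) = w(1) = 0`.
    have hH := (IsPrimitive.const P).mul ((((((IsPrimitive.const (c • (1 : Mat N))).mul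
      (hMw.mul (IsPrimitive.const (n 1)))).sub ((hMw.mul (IsPrimitive.const (n 1))).sub
        ((IsPrimitive.const (n 1)).mul hMw))).add ((hMw.mul hMv).sub (hMv.mul hMw))).sub hG).sub
        ((IsPrimitive.const ((1 / 2 : ℝ) • (1 : Mat N))).mul hB))
    have hVi : Integrable V unitMeasure := by
      have hpi : IntegrableOn p (Icc 0 1) := hMw.integrable
      have hc : ContinuousOn (fun t => n 1 - n t) (Icc 0 1) :=
        (continuous_const.sub (continuous_ext _)).continuousOn
      have h1 : Integrable (fun t => p t * (n 1 - n t)) unitMeasure :=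
        hpi.mul_continuousOn hc isCompact_Icc
      have h2 : Integrable (fun t => (n 1 - n t) * p t) unitMeasure :=
        hpi.continuousOn_mul hc isCompact_Icc
      exact (((hMw.integrable.mul_const _).smul c).sub (h1.sub h2)).const_mul P
    have hLi : Integrable L unitMeasure := by
      refine integrable_finsetSum _ fun μ _ => integrable_finsetSum _ fun ν _ => ?_
      have h : IntegrableOn (levyKernel hA P σ μ ν) (Icc 0 1) := integrable_levyKernel hA P σ μ ν
      exact h.continuousOn_smul ((isPrimitive_position_apply w₀ μ).continuousOn.mul
        (isPrimitive_position_apply v₀ ν).continuousOn) isCompact_Icc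
    have hSi : Integrable S unitMeasure := by
      refine integrable_finsetSum _ fun μ _ => integrable_finsetSum _ fun ν _ => ?_
      have h1 : IntegrableOn (fun t => velocity w₀ t μ) (Icc 0 1) := integrable_velocity_apply w₀ μ
      have h2 : IntegrableOn (fun t => velocity v₀ t μ) (Icc 0 1) := integrable_velocity_apply v₀ μ
      have h3 : IntegrableOn (fun t => velocity w₀ t μ * position v₀ t ν
          + velocity v₀ t μ * position w₀ t ν) (Icc 0 1) :=
        (h1.mul_continuousOn (isPrimitive_position_apply v₀ ν).continuousOn isCompact_Icc).add
        (h2.mul_continuousOn (isPrimitive_position_apply w₀ ν).continuousOn isCompact_Icc)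
      exact h3.smul_continuousOn (continuous_singularKernel hA P σ μ ν).continuousOn isCompact_Icc
    have key := (hH.congr (q := fun t => V t + L t + (1 / 2 : ℝ) • S t)
      fun t _ => ?_).integral_eq (s := 0) (t := 1) (by simp) (by simp)
    · have hsum : (∫ t in (0 : ℝ)..1, V t) + (∫ t in (0 : ℝ)..1, L t)
          + (1 / 2 : ℝ) • (∫ t in (0 : ℝ)..1, S t)
          = ∫ t in (0 : ℝ)..1, (V t + L t + (1 / 2 : ℝ) • S t) := by
        have hVL : Integrable (fun t => V t + L t) unitMeasure := hVi.add hLi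
        have hS2 : Integrable (fun t => (1 / 2 : ℝ) • S t) unitMeasure := hSi.smul (1 / 2 : ℝ)
        rw [intervalIntegral.integral_add (integrable_unit_iff.1 hVL) (integrable_unit_iff.1 hS2),
          intervalIntegral.integral_add (integrable_unit_iff.1 hVi) (integrable_unit_iff.1 hLi),
          intervalIntegral.integral_smul]
      rw [hV, hQ]
      refine Eq.trans ?_ (hsum.trans key).symm
      have hm0 : m 0 = 0 := ext_curvatureForm_zero hA σ w₀
      have hn0 : n 0 = 0 := ext_curvatureForm_zero hA σ v₀
      have hG0 : ext (curvatureFormDeriv hA σ w₀ v₀) 0 = 0 := by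
        simp [curvatureFormDeriv, ext_sum, ext_add, ext_volterra_zero]
      have hw1 : position w₀ 1 = 0 := position_one w
      simp only [hm0, hn0, hG0, hw1, position_zero, PiLp.zero_apply, zero_mul, zero_smul,
        Finset.sum_const_zero, mul_zero, sub_zero, add_zero, smul_mul_assoc, one_mul]
      congr 1
      abel
    · have hid := levy_kernel_identity (fun i => position w₀ t i) (fun i => velocity w₀ t i)
        (fun i => position v₀ t i) (fun i => velocity v₀ t i) (fun i => velocity σ t i)
        (fun μ ν => ext (frame hA (contDiff_curvature hA μ ν) σ) t)
        (fun μ ν => frame_curvature_swap hA σ μ ν t)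
        (fun i μ ν => ext (frame hA (contDiff_covDeriv hA i (contDiff_curvature hA μ ν)) σ) t)
      refine Eq.trans ?_ (add_assoc _ _ _).symm
      refine Eq.trans ?_ (congrArg (fun x => V t + x)
        (Eq.trans (congrArg (fun x => P * x) hid) ?_))
      · simp only [V, zero_mul, mul_zero, zero_add, add_zero, smul_mul_assoc, one_mul]
        rw [← mul_add]
        congr 1
        noncomm_ring
      · simp only [hL, hS, levyKernel, singularKernel, mul_add, mul_smul_comm, Finset.mul_sum]

end Kernels

/-! ### Uniqueness of the Lévy trace -/

section Uniqueness

variable {d N : ℕ} {k : CurveClass}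

theorem eq_zero_of_eq_neg_self {E : Type*} [AddCommGroup E] [Module ℝ E] {x : E}
    (h : x = -x) : x = 0 := by
  have h2 : (2 : ℝ) • x = 0 := by rw [two_smul]; nth_rw 2 [h]; exact add_neg_cancel x
  exact (smul_eq_zero.1 h2).resolve_left two_ne_zero

/-! ### Riemann–Lebesgue limits on `[0,1]`. -/

theorem tendsto_integral_cexp_smul {E : Type*} [NormedAddCommGroup E] [NormedSpace ℂ E]
    {f : ℝ → E} {θ : ℕ → ℝ} (hθ : Tendsto θ atTop (cocompact ℝ)) :
    Tendsto (fun n => ∫ t, Complex.exp ((θ n * t : ℝ) * Complex.I) • f t ∂unitMeasure) atTop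
      (𝓝 0) := by
  -- The rescaling of the frequency turns the Fourier character `exp(-2πi t x)` into `exp(i θ t)`.
  have h1 : Tendsto (fun n => θ n * (-(2 * Real.pi))⁻¹) atTop (cocompact ℝ) := by
    have hne : (-(2 * Real.pi))⁻¹ ≠ 0 := inv_ne_zero (by simp [Real.pi_ne_zero])
    exact ((Homeomorph.mulRight₀ _ hne).isClosedEmbedding.tendsto_cocompact).comp hθ
  have h := (Real.tendsto_integral_exp_smul_cocompact ((Icc (0 : ℝ) 1).indicator f)).comp h1
  refine h.congr fun n => ?_
  rw [← integral_indicator measurableSet_Icc]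
  refine integral_congr_ae (Eventually.of_forall fun t => ?_)
  by_cases ht : t ∈ Icc (0 : ℝ) 1
  · simp only [indicator_of_mem ht, Circle.smul_def, Real.fourierChar_apply]
    congr 3
    have : Real.pi ≠ 0 := Real.pi_ne_zero
    norm_cast
    field_simp
  · simp only [indicator_of_notMem ht, smul_zero]

theorem integrable_cexp_smul {E : Type*} [NormedAddCommGroup E] [NormedSpace ℂ E]
    {f : ℝ → E} (hf : Integrable f unitMeasure) (θ : ℝ) :
    Integrable (fun t => Complex.exp ((θ * t : ℝ) * Complex.I) • f t) unitMeasure := by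
  refine hf.bdd_smul 1 (Continuous.aestronglyMeasurable (by fun_prop))
    (Eventually.of_forall fun t => ?_)
  rw [Complex.norm_exp_ofReal_mul_I]

theorem tendsto_integral_trig_smul {f : ℝ → Mat N} (hf : Integrable f unitMeasure) {θ : ℕ → ℝ}
    (hθ : Tendsto θ atTop atTop) :
    Tendsto (fun n => ∫ t, Real.cos (θ n * t) • f t ∂unitMeasure) atTop (𝓝 0) ∧
    Tendsto (fun n => ∫ t, Real.sin (θ n * t) • f t ∂unitMeasure) atTop (𝓝 0) := by
  have h1 := tendsto_integral_cexp_smul (f := f) (hθ.mono_right atTop_le_cocompact)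
  have h2 := tendsto_integral_cexp_smul (f := f)
    ((tendsto_neg_atTop_atBot.comp hθ).mono_right atBot_le_cocompact)
  have e : ∀ (c : ℂ) (x : Mat N) (r : ℝ), (r : ℂ) = c → r • x = c • x := by
    rintro c x r rfl; exact (Complex.coe_smul r x).symm
  constructor
  · have h := (h1.add h2).const_smul (1 / 2 : ℂ)
    rw [add_zero, smul_zero] at h
    refine h.congr fun n => ?_
    rw [← integral_add (integrable_cexp_smul hf _) (integrable_cexp_smul hf _), ← integral_smul]
    refine integral_congr_ae (Eventually.of_forall fun t => ?_)
    simp only [Function.comp_apply]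
    rw [← add_smul, smul_smul, e _ _ _ (Complex.ofReal_cos _), Complex.cos]
    congr 1
    push_cast
    ring_nf
  · have h := (h1.sub h2).const_smul (-Complex.I / 2 : ℂ)
    rw [sub_zero, smul_zero] at h
    refine h.congr fun n => ?_
    rw [← integral_sub (integrable_cexp_smul hf _) (integrable_cexp_smul hf _), ← integral_smul]
    refine integral_congr_ae (Eventually.of_forall fun t => ?_)
    simp only [Function.comp_apply]
    rw [← sub_smul, smul_smul, e _ _ _ (Complex.ofReal_sin _), Complex.sin]
    congr 1
    push_cast
    ring_nf

/-! ### Smooth test loops, available in all three classes of curves. -/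

theorem exists_velocityFun_eq (k : CurveClass) {f : ℝ → Space d} (hf : Continuous f) :
    ∃ v : VelocitySpace d k, velocityFun k v =ᵐ[unitMeasure] f := by
  obtain ⟨C, hC⟩ := isCompact_Icc.exists_bound_of_continuousOn (s := Icc (0 : ℝ) 1) hf.continuousOn
  have hm : ∀ p, MemLp f p unitMeasure := fun p =>
    MemLp.of_bound hf.aestronglyMeasurable C (by
      filter_upwards [ae_restrict_mem measurableSet_Icc] with t ht using hC t ht)
  cases k with
  | C1 =>
    refine ⟨(⟨fun t => f t, by fun_prop⟩ : C(unitInterval, Space d)), ?_⟩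
    filter_upwards [ae_restrict_mem measurableSet_Icc] with t ht
    change f (Set.projIcc 0 1 zero_le_one t) = f t
    rw [Set.projIcc_of_mem zero_le_one ht]
  | W11 => exact ⟨(hm 1).toLp f, (hm 1).coeFn_toLp⟩
  | W12 => exact ⟨(hm 2).toLp f, (hm 2).coeFn_toLp⟩

theorem exists_curve (k : CurveClass) {f f' : ℝ → Space d} (hf : ∀ t, HasDerivAt f (f' t) t)
    (hf' : Continuous f') (h0 : f 0 = 0) :
    ∃ σ : Curve d k, (∀ t ∈ Icc (0 : ℝ) 1, position σ t = f t) ∧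
      velocity σ =ᵐ[unitMeasure] f' := by
  obtain ⟨v, hv⟩ := exists_velocityFun_eq k hf'
  have hc : Continuous f := continuous_iff_continuousAt.2 fun t => (hf t).continuousAt
  refine ⟨⟨((⟨fun t => f t, by fun_prop⟩ : C(unitInterval, Space d)), v), fun t => ?_⟩,
    fun t ht => ?_, hv⟩
  · change f t = ∫ s in (0 : ℝ)..t, velocityFun k v s
    rw [velocityFun_integral_congr hv t, intervalIntegral.integral_eq_sub_of_hasDerivAt
      (fun s _ => hf s) (hf'.intervalIntegrable _ _), h0, sub_zero]
  · change f (Set.projIcc 0 1 zero_le_one t) = f t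
    rw [Set.projIcc_of_mem zero_le_one ht]

theorem exists_loop_sin (k : CurveClass) (a : Fin d) (n : ℕ) :
    ∃ u : Loop d k, ∀ t ∈ Icc (0 : ℝ) 1,
      position u.1 t = EuclideanSpace.single a (Real.sin (n * Real.pi * t)) := by
  have hs : ∀ x : ℝ, EuclideanSpace.single a x = x • EuclideanSpace.single a (1 : ℝ) := by
    intro x
    ext j
    simp
  obtain ⟨σ, hσ, -⟩ := exists_curve (d := d) k
    (f := fun t => Real.sin (n * Real.pi * t) • EuclideanSpace.single a (1 : ℝ))
    (f' := fun t => (Real.cos (n * Real.pi * t) * (n * Real.pi)) • EuclideanSpace.single a (1 : ℝ))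
    (fun t => by
      have h : HasDerivAt (fun t => Real.sin (n * Real.pi * t))
          (Real.cos (n * Real.pi * t) * (n * Real.pi)) t := by
        simpa using ((hasDerivAt_id t).const_mul (n * Real.pi)).sin
      exact h.smul_const _)
    (by fun_prop) (by simp)
  refine ⟨⟨σ, ?_⟩, fun t ht => (hσ t ht).trans (hs _).symm⟩
  change position σ 1 = 0
  rw [hσ 1 (by simp), mul_one, Real.sin_nat_mul_pi, zero_smul]

/-- For almost every `t` the inner integral tends to zero by Riemann–Lebesgue; `t ↦ ∫ ‖K t s‖ ds`
dominates. -/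
theorem tendsto_double_integral {K : ℝ → ℝ → Mat N}
    (hK : Integrable (fun p : ℝ × ℝ => K p.1 p.2) (unitMeasure.prod unitMeasure)) :
    Tendsto (fun n : ℕ => ∫ t, ∫ s, (Real.sin (n * Real.pi * t) * Real.sin (n * Real.pi * s)) • K t s
      ∂unitMeasure ∂unitMeasure) atTop (𝓝 0) := by
  have hθ : Tendsto (fun n : ℕ => n * Real.pi) atTop atTop :=
    tendsto_natCast_atTop_atTop.atTop_mul_const Real.pi_pos
  have h := tendsto_integral_of_dominated_convergence (μ := unitMeasure)
    (F := fun (n : ℕ) t => ∫ s, (Real.sin (n * Real.pi * t) * Real.sin (n * Real.pi * s)) • K t s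
      ∂unitMeasure) (f := fun _ => (0 : Mat N)) (fun t => ∫ s, ‖K t s‖ ∂unitMeasure) ?_
    hK.norm.integral_prod_left ?_ ?_
  · simpa using h
  · intro n
    have h1 : Integrable (fun p : ℝ × ℝ =>
        (Real.sin (n * Real.pi * p.1) * Real.sin (n * Real.pi * p.2)) • K p.1 p.2)
        (unitMeasure.prod unitMeasure) := by
      have hc : Continuous fun p : ℝ × ℝ =>
          Real.sin (n * Real.pi * p.1) * Real.sin (n * Real.pi * p.2) := by fun_prop
      refine hK.bdd_smul 1 hc.aestronglyMeasurable
        (Eventually.of_forall fun p => ?_)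
      rw [norm_mul]
      exact mul_le_one₀ (Real.abs_sin_le_one _) (norm_nonneg _) (Real.abs_sin_le_one _)
    exact h1.integral_prod_left.aestronglyMeasurable
  · intro n
    filter_upwards [hK.prod_right_ae] with t ht
    refine norm_integral_le_of_norm_le ht.norm (Eventually.of_forall fun s => ?_)
    rw [norm_smul, norm_mul]
    exact mul_le_of_le_one_left (norm_nonneg _)
      (mul_le_one₀ (Real.abs_sin_le_one _) (norm_nonneg _) (Real.abs_sin_le_one _))
  · filter_upwards [hK.prod_right_ae] with t ht
    have h1 := (tendsto_integral_trig_smul ht hθ).2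
    refine squeeze_zero_norm (fun n => ?_) (tendsto_zero_iff_norm_tendsto_zero.1 h1)
    simp only [mul_smul]
    rw [integral_smul, norm_smul]
    exact mul_le_of_le_one_left (norm_nonneg _) (Real.abs_sin_le_one _)

/-- The limit recovers `∫ QL_{aa}` from `Q` alone, whatever the representation. The factor `2`
compensates the mean `1/2` of `sin²`. -/
theorem IsLevyRepresentation.tendsto {Q : Loop d k →L[ℝ] Loop d k →L[ℝ] Mat N}
    {QV : Fin d → Fin d → ℝ → ℝ → Mat N} {QL QS : Fin d → Fin d → ℝ → Mat N}
    (h : IsLevyRepresentation Q QV QL QS) (a : Fin d) {u : ℕ → Loop d k}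
    (hu : ∀ n : ℕ, ∀ t ∈ Icc (0 : ℝ) 1,
      position (u n).1 t = EuclideanSpace.single a (Real.sin (n * Real.pi * t))) :
    Tendsto (fun n => (2 : ℝ) • Q (u n) (u n)) atTop (𝓝 (∫ t, QL a a t ∂unitMeasure)) := by
  have hθ : Tendsto (fun n : ℕ => 2 * (n * Real.pi)) atTop atTop :=
    (tendsto_natCast_atTop_atTop.atTop_mul_const Real.pi_pos).const_mul_atTop two_pos
  have hV := tendsto_double_integral (h.volterra_integrable a a)
  have hL := (tendsto_integral_trig_smul (h.levy_integrable a a) hθ).1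
  have hlim := (hV.const_smul (2 : ℝ)).add ((tendsto_const_nhds
    (x := ∫ t, QL a a t ∂unitMeasure)).sub hL)
  rw [smul_zero, zero_add, sub_zero] at hlim
  refine hlim.congr fun n => ?_
  have hS0 : ∀ᵐ t ∂unitMeasure, QS a a t = 0 := by
    filter_upwards [h.singular_antisymm a a] with t ht using eq_zero_of_eq_neg_self ht
  have e1 : ∫ t in (0 : ℝ)..1, ∫ s in (0 : ℝ)..1, ∑ μ, ∑ ν,
      (position (u n).1 t μ * position (u n).1 s ν) • QV μ ν t s
      = ∫ t, ∫ s, (Real.sin (n * Real.pi * t) * Real.sin (n * Real.pi * s)) • QV a a t s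
        ∂unitMeasure ∂unitMeasure := by
    rw [integral_unit_eq]
    refine integral_congr_ae ?_
    filter_upwards [ae_restrict_mem measurableSet_Icc] with t ht
    rw [integral_unit_eq]
    refine integral_congr_ae ?_
    filter_upwards [ae_restrict_mem measurableSet_Icc] with s hs
    simp [hu n t ht, hu n s hs, ite_mul, mul_ite, ite_smul]
  have e2 : ∫ t in (0 : ℝ)..1, ∑ μ, ∑ ν,
      (position (u n).1 t μ * position (u n).1 t ν) • QL μ ν t
      = (1 / 2 : ℝ) • (∫ t, QL a a t ∂unitMeasure
        - ∫ t, Real.cos (2 * (n * Real.pi) * t) • QL a a t ∂unitMeasure) := by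
    have hci : Integrable (fun t => Real.cos (2 * (n * Real.pi) * t) • QL a a t) unitMeasure := by
      have hc : Continuous fun t => Real.cos (2 * (n * Real.pi) * t) := by fun_prop
      exact (h.levy_integrable a a).bdd_smul 1 hc.aestronglyMeasurable
        (Eventually.of_forall fun t => Real.abs_cos_le_one _)
    rw [← integral_sub (h.levy_integrable a a) hci, ← integral_smul, integral_unit_eq]
    refine integral_congr_ae ?_
    filter_upwards [ae_restrict_mem measurableSet_Icc] with t ht
    have hsin : Real.sin (n * Real.pi * t) * Real.sin (n * Real.pi * t)
        = 1 / 2 * (1 - Real.cos (2 * (n * Real.pi) * t)) := by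
      rw [mul_assoc 2, Real.cos_two_mul, Real.cos_sq']
      ring
    have hsum : ∑ μ, ∑ ν, (position (u n).1 t μ * position (u n).1 t ν) • QL μ ν t
        = (Real.sin (n * Real.pi * t) * Real.sin (n * Real.pi * t)) • QL a a t := by
      simp [hu n t ht, ite_mul, mul_ite, ite_smul]
    rw [hsum, hsin]
    module
  have e3 : ∫ t in (0 : ℝ)..1, ∑ μ, ∑ ν, (velocity (u n).1 t μ * position (u n).1 t ν
      + velocity (u n).1 t μ * position (u n).1 t ν) • QS μ ν t = 0 := by
    -- Only the position of the test loop is prescribed, so its velocity is recovered a.e. as the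
    -- derivative of the position.
    have hz : ∀ᵐ t ∂unitMeasure, ∀ i, i ≠ a → velocity (u n).1 t i = 0 := by
      rw [ae_all_iff]
      intro i
      by_cases hi : i = a
      · exact Eventually.of_forall fun t h => absurd hi h
      have hp := (isPrimitive_position_apply (u n).1 i).deriv
      have h3 : ∀ᵐ t : ℝ ∂unitMeasure, t ≠ 0 :=
        ae_restrict_of_ae (by simp [ae_iff, measure_singleton])
      have h4 : ∀ᵐ t : ℝ ∂unitMeasure, t ≠ 1 :=
        ae_restrict_of_ae (by simp [ae_iff, measure_singleton])
      filter_upwards [hp, ae_restrict_mem measurableSet_Icc, h3, h4] with t hd ht h0 h1 _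
      refine hd.unique ((hasDerivAt_const t (0 : ℝ)).congr_of_eventuallyEq ?_)
      filter_upwards [Ioo_mem_nhds (lt_of_le_of_ne ht.1 h0.symm) (lt_of_le_of_ne ht.2 h1)]
        with s hs
      rw [hu n s ⟨hs.1.le, hs.2.le⟩]
      simp [hi]
    rw [integral_unit_eq, integral_eq_zero_of_ae]
    filter_upwards [hz, hS0, ae_restrict_mem measurableSet_Icc] with t h1 h2 ht
    refine Finset.sum_eq_zero fun μ _ => Finset.sum_eq_zero fun ν _ => ?_
    rw [hu n t ht]
    by_cases hμ : μ = a
    · by_cases hν : ν = a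
      · rw [hμ, hν, h2, smul_zero]
      · simp [hν]
    · simp [h1 μ hμ]
  rw [h.apply_eq, e1, e2, e3]
  module

theorem integral_diagonal_eq {g : Matrix (Fin d) (Fin d) ℝ} (hg : ∀ μ ν, μ ≠ ν → g⁻¹ μ ν = 0)
    {QL : Fin d → Fin d → ℝ → Mat N} (hQL : ∀ μ ν, Integrable (QL μ ν) unitMeasure) :
    ∫ t in (0 : ℝ)..1, ∑ μ, ∑ ν, g⁻¹ μ ν • QL μ ν t
      = ∑ μ, g⁻¹ μ μ • ∫ t, QL μ μ t ∂unitMeasure := by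
  have e : ∀ t, ∑ μ, ∑ ν, g⁻¹ μ ν • QL μ ν t = ∑ μ, g⁻¹ μ μ • QL μ μ t := by
    intro t
    refine Finset.sum_congr rfl fun μ _ => ?_
    refine Finset.sum_eq_single_of_mem μ (Finset.mem_univ _) fun ν _ hν => ?_
    rw [hg μ ν hν.symm, zero_smul]
  simp only [e]
  have hi : ∀ μ, Integrable (fun t => g⁻¹ μ μ • QL μ μ t) unitMeasure := fun μ =>
    (hQL μ μ).smul (g⁻¹ μ μ)
  rw [integral_unit_eq, integral_finsetSum _ fun μ _ => hi μ]
  simp only [integral_smul]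

/-- Since `g⁻¹` is diagonal the trace involves only the numbers `∫ QL_{aa}`, and these are limits of
values of `Q` on oscillating loops. -/
theorem HasLevyTrace.unique {g : Matrix (Fin d) (Fin d) ℝ} (hg : ∀ μ ν, μ ≠ ν → g⁻¹ μ ν = 0)
    {Q : Loop d k →L[ℝ] Loop d k →L[ℝ] Mat N} {T T' : Mat N} (h : HasLevyTrace g Q T)
    (h' : HasLevyTrace g Q T') : T = T' := by
  obtain ⟨QV, QL, QS, hQ, rfl⟩ := h
  obtain ⟨QV', QL', QS', hQ', rfl⟩ := h'
  rw [integral_diagonal_eq hg hQ.levy_integrable, integral_diagonal_eq hg hQ'.levy_integrable]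
  refine Finset.sum_congr rfl fun a _ => ?_
  choose u hu using exists_loop_sin (d := d) k a
  rw [tendsto_nhds_unique (hQ.tendsto a hu) (hQ'.tendsto a hu)]

theorem IsLevyRepresentation.levyTrace_eq {g : Matrix (Fin d) (Fin d) ℝ}
    (hg : ∀ μ ν, μ ≠ ν → g⁻¹ μ ν = 0) {Q : Loop d k →L[ℝ] Loop d k →L[ℝ] Mat N}
    {QV : Fin d → Fin d → ℝ → ℝ → Mat N} {QL QS : Fin d → Fin d → ℝ → Mat N}
    (h : IsLevyRepresentation Q QV QL QS) :
    levyTrace g Q = ∫ t in (0 : ℝ)..1, ∑ μ, ∑ ν, g⁻¹ μ ν • QL μ ν t := by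
  have h1 : HasLevyTrace g Q (∫ t in (0 : ℝ)..1, ∑ μ, ∑ ν, g⁻¹ μ ν • QL μ ν t) :=
    ⟨QV, QL, QS, h, rfl⟩
  exact (Classical.epsilon_spec (p := HasLevyTrace g Q) ⟨_, h1⟩).unique hg h1

theorem inv_metric_apply_ne {g : Matrix (Fin d) (Fin d) ℝ}
    (hg : g = euclideanMetric d ∨ g = minkowskiMetric d) (μ ν : Fin d) (h : μ ≠ ν) :
    g⁻¹ μ ν = 0 := by
  rcases hg with rfl | rfl
  · rw [euclideanMetric, inv_one, Matrix.one_apply_ne h]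
  · rw [minkowskiMetric, Matrix.inv_diagonal, Matrix.diagonal_apply_ne _ h]

end Uniqueness

/-! ### The Lévy trace of the kernels -/

section Trace

variable {d N : ℕ} {k : CurveClass} {A : Fin d → Space d → Mat N}
  (hA : ∀ μ, ContDiff ℝ ∞ (A μ))

/-- Off the diagonal `g⁻¹` vanishes; on it `∇_κ F_{ll} = 0` removes the symmetrizing half term,
leaving the Yang–Mills current. -/
theorem sum_levyKernel {g : Matrix (Fin d) (Fin d) ℝ} (hg : ∀ μ ν, μ ≠ ν → g⁻¹ μ ν = 0)
    (P : Mat N) (σ : Curve d k) (t : ℝ) :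
    ∑ μ, ∑ ν, g⁻¹ μ ν • levyKernel hA P σ μ ν t
      = P * -(ext (cotransport hA σ) t * (∑ l, ∑ μ, ∑ ν, (g⁻¹ l μ * velocity σ t ν) •
        covDeriv A l (curvature A μ ν) (position σ t)) * ext (transport hA σ) t) := by
  have e : ∀ l μ, g⁻¹ l μ • levyKernel hA P σ l μ t = P * -(ext (cotransport hA σ) t *
      (∑ ν, (g⁻¹ l μ * velocity σ t ν) • covDeriv A l (curvature A μ ν) (position σ t))
        * ext (transport hA σ) t) := by
    intro l μ
    by_cases h : l = μ
    · subst h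
      have hz : ∀ κ, ext (frame hA (contDiff_covDeriv hA κ (contDiff_curvature hA l l)) σ) t = 0 :=
        fun κ => eq_zero_of_eq_neg_self (frame_covDeriv_curvature_swap hA σ κ l l t)
      simp only [levyKernel, hz, smul_zero, add_zero, ext_frame, Finset.mul_sum, Finset.sum_mul,
        mul_smul_comm, smul_mul_assoc, mul_neg, smul_neg, Finset.smul_sum, smul_smul]
    · simp [hg l μ h]
  simp only [e, ← Finset.mul_sum, Finset.sum_neg_distrib, ← Finset.sum_mul]

theorem integral_sum_levyKernel {g : Matrix (Fin d) (Fin d) ℝ}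
    (hg : ∀ μ ν, μ ≠ ν → g⁻¹ μ ν = 0) (P : Mat N) (σ : Curve d k) :
    ∫ t in (0 : ℝ)..1, ∑ μ, ∑ ν, g⁻¹ μ ν • levyKernel hA P σ μ ν t
      = P * -(∫ t in (0 : ℝ)..1, parallelTransport A 0 t σ *
          (∑ l, ∑ μ, ∑ ν, (g⁻¹ l μ * velocity σ t ν) •
            covDeriv A l (curvature A μ ν) (position σ t)) *
          parallelTransport A t 0 σ) := by
  have e : ∫ t in (0 : ℝ)..1, parallelTransport A 0 t σ *
          (∑ l, ∑ μ, ∑ ν, (g⁻¹ l μ * velocity σ t ν) •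
            covDeriv A l (curvature A μ ν) (position σ t)) * parallelTransport A t 0 σ
      = ∫ t in (0 : ℝ)..1, ext (cotransport hA σ) t *
          (∑ l, ∑ μ, ∑ ν, (g⁻¹ l μ * velocity σ t ν) •
            covDeriv A l (curvature A μ ν) (position σ t)) * ext (transport hA σ) t := by
    refine intervalIntegral.integral_congr fun t ht => ?_
    rw [uIcc_of_le zero_le_one] at ht
    simp only [parallelTransport_zero_left hA σ ht, parallelTransport_zero_right hA σ ht]
  have hi : Integrable (fun t => -(ext (cotransport hA σ) t *
      (∑ l, ∑ μ, ∑ ν, (g⁻¹ l μ * velocity σ t ν) •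
        covDeriv A l (curvature A μ ν) (position σ t)) * ext (transport hA σ) t)) unitMeasure := by
    -- Integrability of the framed current is read off from that of the Lévy kernel with `P = 1`.
    have h : Integrable (fun t => ∑ μ, ∑ ν, g⁻¹ μ ν • levyKernel hA 1 σ μ ν t) unitMeasure :=
      integrable_finsetSum _ fun μ _ => integrable_finsetSum _ fun ν _ =>
        (integrable_levyKernel hA 1 σ μ ν).smul (g⁻¹ μ ν)
    simpa only [sum_levyKernel hA hg, one_mul] using h
  simp only [sum_levyKernel hA hg]
  rw [e, integral_unit_eq, integral_unit_eq, integral_const_mul_of_integrable hi, integral_neg]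

end Trace

end LevyYM

/-! ### The proposition. -/

theorem mainTheorem7 {d N : ℕ} (k : CurveClass)
    (g : Matrix (Fin d) (Fin d) ℝ) (hg : g = euclideanMetric d ∨ g = minkowskiMetric d)
    (G : Subgroup (Matrix.unitaryGroup (Fin N) ℂ))
    (hG : IsClosed (G : Set (Matrix.unitaryGroup (Fin N) ℂ)))
    (A : Fin d → Space d → Mat N) (hA : ∀ μ, ContDiff ℝ ∞ (A μ))
    (hAG : ∀ μ x, A μ x ∈ lieAlgebra G) :
    InDivergenceDomain (transportForm A : Curve d k → (Loop d k →L[ℝ] Mat N)) ∧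
    InSecondOrderDomain (parallelTransport A 1 0 : Curve d k → Mat N) ∧
    ∀ σ : Curve d k,
      levyDivergence g (transportForm A) σ =
        -(∫ t in (0 : ℝ)..1, parallelTransport A 0 t σ *
          (∑ l, ∑ μ, ∑ ν, (g⁻¹ l μ * velocity σ t ν) •
            covDeriv A l (curvature A μ ν) (position σ t)) *
          parallelTransport A t 0 σ) ∧
      -(∫ t in (0 : ℝ)..1, parallelTransport A 0 t σ *
          (∑ l, ∑ μ, ∑ ν, (g⁻¹ l μ * velocity σ t ν) •
            covDeriv A l (curvature A μ ν) (position σ t)) *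
          parallelTransport A t 0 σ) =
        parallelTransport A 0 1 σ * levySecondOrder g (parallelTransport A 1 0) σ := by
  have hg' := inv_metric_apply_ne hg
  -- `P = 1` and `c = 0`: the derivative of `B^A` contains no product `M_w(1) M_v(1)`.
  have hdiv : ∀ σ : Curve d k, IsLevyRepresentation (firstDerivative (transportForm A) σ)
      (volterraKernel hA 1 0 σ) (levyKernel hA 1 σ) (singularKernel hA 1 σ) := fun σ =>
    isLevyRepresentation_kernels hA 1 0 σ fun w v => by
      rw [firstDerivative_transportForm hA, one_mul, zero_smul, zero_sub]
  -- `P = U_{1,0}` and `c = 1`: compared with `hdiv`, the Lévy kernel only gains the left factor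
  -- `U_{1,0}`, which `U_{0,1}` cancels in the final equality.
  have hlap : ∀ σ : Curve d k, IsLevyRepresentation (secondDerivative (parallelTransport A 1 0) σ)
      (volterraKernel hA (parallelTransport A 1 0 σ) 1 σ)
      (levyKernel hA (parallelTransport A 1 0 σ) σ)
      (singularKernel hA (parallelTransport A 1 0 σ) σ) := fun σ =>
    isLevyRepresentation_kernels hA _ 1 σ fun w v => by
      rw [secondDerivative_parallelTransport hA, one_smul]
  refine ⟨⟨(contDiff_transportForm hA).of_le (by simp), fun σ => ⟨_, _, _, hdiv σ⟩⟩,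
    ⟨contDiff_infty.1 (contDiff_parallelTransport_one_zero hA) 2, fun σ => ⟨_, _, _, hlap σ⟩⟩,
    fun σ => ⟨?_, ?_⟩⟩
  · rw [levyDivergence, (hdiv σ).levyTrace_eq hg', integral_sum_levyKernel hA hg', one_mul]
  · rw [levySecondOrder, (hlap σ).levyTrace_eq hg', integral_sum_levyKernel hA hg', ← mul_assoc,
      parallelTransport_zero_one_mul hA, one_mul]
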